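/- Let $\Omega\subset\mathbb R^n$ be a bounded domain containing $0$, let $f:\Omega\to\mathbb R^n$, $g:\Omega\to\mathbb R^{n\times m}$, $q:\Omega\to\mathbb R$ be Lipschitz continuous with $g$ of class $C^\infty$, let $r>0$ and $R(x)=r^{-1}g(x)g(x)^T$. Here $|\cdot|$ is the Euclidean norm, or the induced operator norm for matrices. Assume $f(x)=Ax+O(|x|^2)$ and $q(x)=\frac12x^TQx+O(|x|^3)$ as $x\to0$, with $A,Q\in\mathbb R^{n\times n}$ and $Q$ symmetric. Assume that the Hamiltonian matrix $$\begin{pmatrix}A&-R(0)\\-Q&-A^T\end{pmatrix}$$ has no eigenvalue on the imaginary axis, and that the real generalized eigenspace $E_-$ of its eigenvalues with negative real part satisfies $E_-\oplus\operatorname{Im}(0,I_n)^T=\mathbb R^{2n}$. Let $V$ be a stabilizing solution on $\Omega$ of the Hamilton–Jacobi equation $\nabla V^Tf-\frac12\nabla V^TR\nabla V+q=0$; that is, $V$ is differentiable and solves the equation on $\Omega$, $\nabla V(0)=0$, and $0$ is an asymptotically stable equilibrium of $\dot x=f(x)-R(x)\nabla V(x)$. Put $p=\nabla V$. Assume that $p$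 is Lipschitz continuous on $\Omega$ and differentiable at $0$, and put $P=\frac{\partial^2V}{\partial x^2}(0)$. The neural networks $p^{NN}(\theta,\cdot):\mathbb R^n\to\mathbb R^n$ are those of the following form, with any width $M$, any number $\ell$ of layers and any real parameters $\theta$ (all the $U,W,b$ below). With $\sigma=\sin$ applied coordinatewise and $\odot$ the coordinatewise product, $S^1=\sigma(W^1x+b^1)$ and, for $i=1,\dots,\ell$, $$Z^i=\sigma(U^{z,i}x+W^{z,i}S^i+b^{z,i}),\quad G^i=\sigma(U^{g,i}x+W^{g,i}S^i+b^{g,i}),\quad R^i=\sigma(U^{r,i}x+W^{r,i}S^i+b^{r,i}),$$ $$H^i=\sigma(U^{h,i}x+W^{h,i}(S^i\odot R^i)+b^{h,i}),\qquad S^{i+1}=(1-G^i)\odot H^i+Z^i\odot S^i,$$ and $p^{NN}(\theta,x)=WS^{\ell+1}+b$, with $S^i\in\mathbb R^M$. **Theorem.** There is a constant $C_0>0$, depending only on $f,g,R,p$ (on $\Omega$), such that the following holds for every common Lipschitz constant $L$ of $f,g,R,p$ on $\Omega$ and all $\gamma_0>0$, $k>0$. There are $\varepsilon_0\in(0,\gamma_0)$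 and $\alpha>0$ such that for every $x_0$ for which the solution $x$ of $$\dot x=f(x)-R(x)p(x),\qquad x(0)=x_0,$$ exists in $\Omega$ for all $t\ge0$ and tends to $0$ as $t\to\infty$, there is $\varepsilon\in(0,\varepsilon_0)$ such that for every admissible time $T_\varepsilon$ of $x$ with respect to $\varepsilon$ (that is, $T_\varepsilon>0$ and $|x(t)|<\varepsilon/2$ for all $t\ge T_\varepsilon$) there is $\delta_0>0$ with the following property. For every $\delta\in(0,\delta_0]$ and every network $p^{NN}(\theta,\cdot)$ with $$|p^{NN}(\theta,x)-Px|\le k|x|^2\ \text{ for }|x|<\gamma_0,\qquad |p^{NN}(\theta,x)-p(x)|<\delta\ \text{ for }x\in\Omega,$$ the closed-loop equation $$\dot x^{NN}=f(x^{NN})-R(x^{NN})\,p^{NN}(\theta,x^{NN}),\qquad x^{NN}(0)=x_0,$$ has a solution in $\Omega$ for all $t\ge0$, and every such solution satisfies $$|x^{NN}(t)-x(t)|\le C_0\,\delta\, e^{C_0Lt},\quad 0\le t\le T_\varepsilon,\qquad\text{and}\qquad |x^{NN}(t)|\le\varepsilon_0e^{-\alpha t},\quad t>T_\varepsilon.$$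 -/

import Mathlib

open Set Filter Topology
open scoped NNReal ContDiff Matrix Matrix.Norms.L2Operator

noncomputable section

/-- Euclidean space of dimension `n`; matrices carry the induced operator norm. -/
abbrev E (n : ℕ) : Type := EuclideanSpace ℝ (Fin n)

/-- The matrix-vector product on Euclidean spaces. -/
def act {n m : ℕ} (M : Matrix (Fin n) (Fin m) ℝ) (v : E m) : E n :=
  WithLp.toLp 2 (M *ᵥ v.ofLp)

/-- `R(x) = r⁻¹ g(x) g(x)ᵀ`. -/
def controlMatrix {n m : ℕ} (r : ℝ) (g : E n → Matrix (Fin n) (Fin m) ℝ) (x : E n) :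
    Matrix (Fin n) (Fin n) ℝ :=
  r⁻¹ • (g x * (g x)ᵀ)

/-- A bounded domain (open connected set) of `ℝⁿ` that contains the origin. -/
structure IsBoundedDomain {n : ℕ} (Ω : Set (E n)) : Prop where
  isOpen : IsOpen Ω
  connected : IsConnected Ω
  bounded : Bornology.IsBounded Ω
  zero_mem : (0 : E n) ∈ Ω

/-- Regularity of the control problem: `f`, `q`, `g` are Lipschitz continuous on `Ω`,
`g` is smooth on `Ω`, and near the origin `f(x) = A x + O(|x|²)`,
`q(x) = ½ xᵀ Q x + O(|x|³)` with `Q` symmetric. -/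
structure CondC1 {n m : ℕ} (Ω : Set (E n)) (f : E n → E n)
    (g : E n → Matrix (Fin n) (Fin m) ℝ) (q : E n → ℝ)
    (A Q : Matrix (Fin n) (Fin n) ℝ) : Prop where
  lip_f : ∃ K : ℝ≥0, LipschitzOnWith K f Ω
  lip_q : ∃ K : ℝ≥0, LipschitzOnWith K q Ω
  lip_g : ∃ K : ℝ≥0, LipschitzOnWith K g Ω
  smooth_g : ContDiffOn ℝ ∞ g Ω
  symm_Q : Q.IsSymm
  expand_f : (fun x : E n => f x - act A x) =O[𝓝 0] (fun x : E n => ‖x‖ ^ 2)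
  expand_q : (fun x : E n => q x - 1 / 2 * inner ℝ x (act Q x)) =O[𝓝 0]
    (fun x : E n => ‖x‖ ^ 3)

/-- The Hamiltonian matrix `[[A, -R₀], [-Q, -Aᵀ]]`. -/
def hamiltonianMatrix {n : ℕ} (A R₀ Q : Matrix (Fin n) (Fin n) ℝ) :
    Matrix (Fin n ⊕ Fin n) (Fin n ⊕ Fin n) ℝ :=
  Matrix.fromBlocks A (-R₀) (-Q) (-Aᵀ)

/-- The complexification of a real square matrix, as an endomorphism of `ℂ^ι`. -/
def complexEnd {ι : Type} [Fintype ι] [DecidableEq ι] (H : Matrix ι ι ℝ) :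
    Module.End ℂ (ι → ℂ) :=
  Matrix.toLin' (H.map (algebraMap ℝ ℂ))

/-- A real matrix is hyperbolic if it has no complex eigenvalue on the imaginary axis. -/
def IsHyperbolic {ι : Type} [Fintype ι] [DecidableEq ι] (H : Matrix ι ι ℝ) : Prop :=
  ∀ μ : ℂ, (complexEnd H).HasEigenvalue μ → μ.re ≠ 0

/-- The real generalized eigenspace `E₋` of the stable eigenvalues: the real vectors that lie
in the sum of the complex generalized eigenspaces of the eigenvalues with `Re μ < 0`. -/
def stableSubspace {ι : Type} [Fintype ι] [DecidableEq ι] (H : Matrix ι ι ℝ) :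
    Submodule ℝ (ι → ℝ) :=
  ((⨆ μ : {μ : ℂ // μ.re < 0},
      (complexEnd H).maxGenEigenspace (μ : ℂ)).restrictScalars ℝ).comap
    ((Algebra.linearMap ℝ ℂ).compLeft ι)

/-- The image of `(0, Iₙ)ᵀ` in `ℝ²ⁿ`: the vectors whose first `n` coordinates vanish. -/
def verticalSubspace (n : ℕ) : Submodule ℝ (Fin n ⊕ Fin n → ℝ) where
  carrier := {v | ∀ i : Fin n, v (Sum.inl i) = 0}
  add_mem' := by
    intro a b ha hb i
    simp [ha i, hb i]
  zero_mem' := fun _ => rfl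
  smul_mem' := by
    intro c a ha i
    simp [ha i]

/-- The Hamiltonian matrix is hyperbolic and `E₋ ⊕ Im (0, Iₙ)ᵀ = ℝ²ⁿ`. -/
structure CondC2 {n : ℕ} (A R₀ Q : Matrix (Fin n) (Fin n) ℝ) : Prop where
  hyperbolic : IsHyperbolic (hamiltonianMatrix A R₀ Q)
  complementary : IsCompl (stableSubspace (hamiltonianMatrix A R₀ Q)) (verticalSubspace n)

/-- `x` is a solution in `Ω`, for all times `t ≥ 0`, of `ẋ = F(x)`, `x(0) = x₀`. -/
def IsSolution {n : ℕ} (Ω : Set (E n)) (F : E n → E n) (x₀ : E n) (x : ℝ → E n) : Prop :=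
  x 0 = x₀ ∧ ∀ t : ℝ, 0 ≤ t → x t ∈ Ω ∧ HasDerivWithinAt x (F (x t)) (Ici 0) t

/-- `0` is an asymptotically stable equilibrium of the vector field `F` on `Ω`:
it is an equilibrium, it is Lyapunov stable, and it attracts all nearby solutions. -/
structure IsAsymptoticallyStable {n : ℕ} (Ω : Set (E n)) (F : E n → E n) : Prop where
  equilibrium : F 0 = 0
  stable : ∀ ε : ℝ, 0 < ε → ∃ η : ℝ, 0 < η ∧ ∀ x₀ : E n, ‖x₀‖ < η →
    (∃ x : ℝ → E n, IsSolution Ω F x₀ x) ∧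
    ∀ x : ℝ → E n, IsSolution Ω F x₀ x → ∀ t : ℝ, 0 ≤ t → ‖x t‖ < ε
  attractive : ∃ η : ℝ, 0 < η ∧ ∀ x₀ : E n, ‖x₀‖ < η →
    ∀ x : ℝ → E n, IsSolution Ω F x₀ x → Tendsto x atTop (𝓝 0)

/-- The closed-loop vector field `f(x) - R(x) p(x)` of a costate feedback `p`. -/
def closedLoop {n m : ℕ} (f : E n → E n) (g : E n → Matrix (Fin n) (Fin m) ℝ) (r : ℝ)
    (p : E n → E n) (x : E n) : E n :=
  f x - act (controlMatrix r g x) (p x)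

/-- `V` is a stabilizing solution on `Ω` of the Hamilton-Jacobi equation
`∇V(x)ᵀ f(x) - ½ ∇V(x)ᵀ R(x) ∇V(x) + q(x) = 0`. -/
structure IsStabilizingSolution {n m : ℕ} (Ω : Set (E n)) (f : E n → E n)
    (g : E n → Matrix (Fin n) (Fin m) ℝ) (q : E n → ℝ) (r : ℝ) (V : E n → ℝ) : Prop where
  differentiable : DifferentiableOn ℝ V Ω
  hamiltonJacobi : ∀ x ∈ Ω, inner ℝ (gradient V x) (f x)
    - 1 / 2 * inner ℝ (gradient V x) (act (controlMatrix r g x) (gradient V x)) + q x = 0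
  gradient_zero : gradient V 0 = 0
  stabilizing : IsAsymptoticallyStable Ω (closedLoop f g r (gradient V))

/-- `T` is an admissible time of the trajectory `x` with respect to `ε`. -/
def IsAdmissibleTime {n : ℕ} (x : ℝ → E n) (ε T : ℝ) : Prop :=
  0 < T ∧ ∀ t : ℝ, T ≤ t → ‖x t‖ < ε / 2

/-- The coordinatewise activation function `σ(z) = (sin z₁, …, sin z_M)`. -/
def sinAct {M : ℕ} (z : Fin M → ℝ) : Fin M → ℝ := fun j => Real.sin (z j)

/-- The parameters `U`, `W`, `b` of one gate `σ(U x + W S + b)` of the network. -/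
structure Gate (n M : ℕ) where
  U : Matrix (Fin M) (Fin n) ℝ
  W : Matrix (Fin M) (Fin M) ℝ
  b : Fin M → ℝ

/-- The map `(x, S) ↦ σ(U x + W S + b)`. -/
def Gate.eval {n M : ℕ} (a : Gate n M) (x : Fin n → ℝ) (S : Fin M → ℝ) : Fin M → ℝ :=
  sinAct (a.U *ᵥ x + a.W *ᵥ S + a.b)

/-- The parameters of one recurrent layer: its gates `Z`, `G`, `R`, `H`. -/
structure Layer (n M : ℕ) where
  gZ : Gate n M
  gG : Gate n M
  gR : Gate n M
  gH : Gate n M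

/-- The step `S ↦ (1 - G) ⊙ H + Z ⊙ S` of a layer, in which the gate `H` is evaluated
at `S ⊙ R`; the product `*` of vectors is coordinatewise. -/
def Layer.step {n M : ℕ} (a : Layer n M) (x : Fin n → ℝ) (S : Fin M → ℝ) : Fin M → ℝ :=
  (1 - a.gG.eval x S) * a.gH.eval x (S * a.gR.eval x S) + a.gZ.eval x S * S

/-- The parameters `θ` of a network with `n` inputs, `n` outputs, `M` units in each sub-layer
and `layers.length + 1` hidden layers. -/
structure NNParams (n M : ℕ) where
  W₁ : Matrix (Fin M) (Fin n) ℝ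
  b₁ : Fin M → ℝ
  layers : List (Layer n M)
  W : Matrix (Fin n) (Fin M) ℝ
  b : Fin n → ℝ

/-- The network `p^NN(θ, ·)`: start from `S¹ = σ(W¹ x + b¹)`, apply the layers one after the
other, and return `W S + b` for the last state `S`. -/
def NNParams.eval {n M : ℕ} (θ : NNParams n M) (x : E n) : E n :=
  WithLp.toLp 2
    (θ.W *ᵥ (θ.layers.foldl (fun S a => a.step x.ofLp S) (sinAct (θ.W₁ *ᵥ x.ofLp + θ.b₁))) + θ.b)

end

/-! Near the origin everything is governed by the matrix `B = A - R(0) P`. Expanding the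
Hamilton–Jacobi equation to second order along rays gives the Riccati equation for `P`
(`riccati_of_hamiltonJacobi`), so `v ↦ (v, Pv)` carries eigenvectors of `B` to eigenvectors of the
Hamiltonian matrix, and `B` is hyperbolic. A hyperbolic matrix has a quadratic form that strictly
increases along its flow (`exists_lyapunov_of_isHyperbolic`). Lyapunov stability of the nonlinear
loop forces this form to be negative definite, and its negative is a Lyapunov function
(`exists_isLyapunovForm`).

This Lyapunov function serves every field that is relatively close to `B` near `0`, hence all
admissible networks at once. Up to time `T` Gronwall's inequality compares the two trajectories
inside a tube around `x` (`norm_sub_le_gronwallBound_of_tube`); afterwards the Lyapunov function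
gives decay (`IsLyapunovForm.norm_le_of_ball`).

The decay bound counts time from `0`, not from `T`, so `y(T)` must already be of size `exp(-αT)`.
This is arranged by interpolating between `|x(T)| < ε/2` and the exponential decay of `x`, at the
price of half the rate. -/

/-! ### Continuation, differential inequalities and global existence -/

/-- A property that holds initially, persists for a short time and passes to the limit from the
left holds for all later times. -/
theorem forall_ge_of_forall_Ico {P : ℝ → Prop} {a : ℝ}
    (hstep : ∀ t, a ≤ t → (∀ s ∈ Ico a t, P s) → P t)
    (hopen : ∀ t, a ≤ t → P t → ∀ᶠ s in 𝓝[>] t, P s) : ∀ t, a ≤ t → P t := by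
  by_contra! hcon
  obtain ⟨t₁, hat₁, ht₁⟩ := hcon
  set B : Set ℝ := {t | a ≤ t ∧ ¬ P t} with hB
  have hne : B.Nonempty := ⟨t₁, hat₁, ht₁⟩
  have hbdd : BddBelow B := ⟨a, fun t ht => ht.1⟩
  have ha : a ≤ sInf B := le_csInf hne fun t ht => ht.1
  have hPs : P (sInf B) := by
    refine hstep _ ha fun s hs => ?_
    by_contra h
    exact absurd (csInf_le hbdd (show s ∈ B from ⟨hs.1, h⟩)) (not_le.2 hs.2)
  obtain ⟨u, hu, hPu⟩ := (eventually_nhdsWithin_iff.1 (hopen _ ha hPs)).exists_mem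
  obtain ⟨η, hη, hball⟩ := Metric.mem_nhds_iff.1 hu
  obtain ⟨s, hsB, hs⟩ := exists_lt_of_csInf_lt hne (show sInf B < sInf B + η by linarith)
  have hle := csInf_le hbdd hsB
  rcases hle.eq_or_lt with h | h
  · exact hsB.2 (h ▸ hPs)
  · exact hsB.2 (hPu s (hball (by rw [Metric.mem_ball, Real.dist_eq, abs_of_pos] <;> linarith)) h)

/-- The differential inequality `w' ≤ -b w` integrates to exponential decay. -/
theorem le_mul_exp_of_hasDerivWithinAt_le {w w' : ℝ → ℝ} {a t b : ℝ} (hat : a ≤ t)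
    (hc : ContinuousOn w (Icc a t))
    (hd : ∀ s ∈ Ico a t, HasDerivWithinAt w (w' s) (Ici s) s)
    (hle : ∀ s ∈ Ico a t, w' s ≤ -b * w s) : w t ≤ w a * Real.exp (-b * (t - a)) := by
  have := le_gronwallBound_of_liminf_deriv_right_le (f := w) (f' := w') (δ := w a) (K := -b)
    (ε := 0) hc (fun s hs r hr => (hd s hs).liminf_right_slope_le hr) le_rfl
    (fun s hs => by simpa using hle s hs) t ⟨hat, le_rfl⟩
  rwa [gronwallBound_ε0] at this

theorem hasDerivWithinAt_inner_self {n : ℕ} {N : E n →L[ℝ] E n}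
    (hN : ∀ u v, inner ℝ u (N v) = inner ℝ (N u) v) {y : ℝ → E n} {y' : E n} {s : Set ℝ} {t : ℝ}
    (hy : HasDerivWithinAt y y' s t) :
    HasDerivWithinAt (fun t => (inner ℝ (y t) (N (y t)) : ℝ)) (2 * inner ℝ (N (y t)) y') s t := by
  have h := hy.inner ℝ (N.hasFDerivAt.comp_hasDerivWithinAt t hy)
  have e : (inner ℝ (y t) (N y') + inner ℝ y' (N (y t)) : ℝ) = 2 * inner ℝ (N (y t)) y' := by
    rw [hN, real_inner_comm (N (y t)) y']
    ring
  rw [← e]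
  exact h

/-- Global solutions exist for bounded, globally Lipschitz vector fields. -/
theorem exists_solution_of_bounded_lipschitz {X : Type*} [NormedAddCommGroup X] [NormedSpace ℝ X]
    [CompleteSpace X] {H : X → X} {K B : ℝ≥0} (hK : LipschitzWith K H) (hB : ∀ x, ‖H x‖ ≤ B)
    (x₀ : X) :
    ∃ y : ℝ → X, y 0 = x₀ ∧ ∀ t, 0 ≤ t → HasDerivWithinAt y (H (y t)) (Ici 0) t := by
  have hloc : ∀ N : ℕ, ∃ y : ℝ → X, y 0 = x₀ ∧
      ∀ t ∈ Icc (0 : ℝ) N, HasDerivWithinAt y (H (y t)) (Icc 0 N) t := by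
    intro N
    -- The radius `B * N` is the farthest that a field bounded by `B` can travel in time `N`.
    have hpl : IsPicardLindelof (fun _ => H) (tmin := 0) (tmax := N)
        ⟨0, le_rfl, Nat.cast_nonneg N⟩ x₀ (B * N) 0 B K :=
      IsPicardLindelof.of_time_independent (fun x _ => hB x) (hK.lipschitzOnWith) (by simp)
    exact hpl.exists_eq_forall_mem_Icc_hasDerivWithinAt₀
  choose y hy0 hy using hloc
  have hcont : ∀ N, ContinuousOn (y N) (Icc 0 N) := fun N t ht => (hy N t ht).continuousWithinAt
  have hright : ∀ N : ℕ, ∀ t ∈ Ico (0 : ℝ) N, HasDerivWithinAt (y N) (H (y N t)) (Ici t) t := by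
    intro N t ht
    refine ((hy N t ⟨ht.1, ht.2.le⟩).mono (Icc_subset_Icc_left ht.1)).mono_of_mem_nhdsWithin ?_
    exact Icc_mem_nhdsGE ht.2
  have hagree : ∀ N M : ℕ, N ≤ M → ∀ t ∈ Icc (0 : ℝ) N, y N t = y M t := by
    intro N M hNM t ht
    have hNM' : (N : ℝ) ≤ M := by exact_mod_cast hNM
    refine ODE_solution_unique_of_mem_Icc_right (v := fun _ => H) (s := fun _ => univ)
      (fun t _ => hK.lipschitzOnWith) (hcont N) (hright N) (fun _ _ => trivial)
      ((hcont M).mono (Icc_subset_Icc_right hNM'))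
      (fun t ht => hright M t ⟨ht.1, ht.2.trans_le hNM'⟩) (fun _ _ => trivial)
      (by rw [hy0, hy0]) ht
  have hfloor : ∀ N : ℕ, ∀ t ∈ Icc (0 : ℝ) N, y (⌊t⌋₊ + 1) t = y N t := by
    intro N t ht
    have h1 : t ∈ Icc (0 : ℝ) (⌊t⌋₊ + 1 : ℕ) := ⟨ht.1, by
      push_cast; exact (Nat.lt_floor_add_one t).le⟩
    rcases le_total N (⌊t⌋₊ + 1) with h | h
    · exact (hagree _ _ h t ht).symm
    · exact hagree _ _ h t h1
  -- The index `⌊t⌋₊ + 1` keeps `t` strictly below the right end of the interval, so the derivative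
  -- within `[0, N]` is one within `[0, ∞)`.
  refine ⟨fun t => y (⌊t⌋₊ + 1) t, by simp [hy0], fun t ht => ?_⟩
  set N : ℕ := ⌊t⌋₊ + 1 with hN
  have htN : t < N := by rw [hN]; push_cast; exact Nat.lt_floor_add_one t
  have h1 : HasDerivWithinAt (y N) (H (y N t)) (Ici 0) t :=
    (hy N t ⟨ht, htN.le⟩).mono_of_mem_nhdsWithin
      (by rw [← Ici_inter_Iic]; exact inter_mem_nhdsWithin _ (Iic_mem_nhds htN))
  refine h1.congr_of_eventuallyEq ?_ rfl
  have : Iic (N : ℝ) ∈ 𝓝[Ici 0] t := mem_nhdsWithin_of_mem_nhds (Iic_mem_nhds htN)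
  filter_upwards [this, self_mem_nhdsWithin] with s hs hs0
  exact hfloor N s ⟨hs0, hs⟩

/-- A bounded Lipschitz field on a set extends to a bounded Lipschitz field on the whole space. -/
theorem exists_bounded_lipschitz_extension {n : ℕ} {Ω : Set (E n)} {F : E n → E n} {K B : ℝ≥0}
    (hK : LipschitzOnWith K F Ω) (hB : ∀ x ∈ Ω, ‖F x‖ ≤ B) :
    ∃ (H : E n → E n) (K' B' : ℝ≥0), LipschitzWith K' H ∧ (∀ x, ‖H x‖ ≤ B') ∧ EqOn F H Ω := by
  obtain ⟨G, hG, hFG⟩ :=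
    ((PiLp.lipschitzWith_ofLp 2 (fun _ : Fin n => ℝ)).comp_lipschitzOnWith hK).extend_pi
  -- A Lipschitz extension need not be bounded; clamping each coordinate to `[-B, B]` bounds it and
  -- changes nothing on `Ω`.
  set c : (Fin n → ℝ) → (Fin n → ℝ) := fun v i => max (-(B : ℝ)) (min B (v i)) with hc
  have hcl : LipschitzWith 1 c := by
    refine LipschitzWith.of_dist_le_mul fun v w => ?_
    simp only [NNReal.coe_one, one_mul]
    refine (dist_pi_le_iff dist_nonneg).2 fun i => ?_
    have h1 : LipschitzWith 1 (fun s : ℝ => max (-(B : ℝ)) (min B s)) :=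
      (LipschitzWith.id.const_min _).const_max _
    have := h1.dist_le_mul (v i) (w i)
    simp only [NNReal.coe_one, one_mul] at this
    exact this.trans (dist_le_pi_dist v w i)
  have hcn : ∀ v, ‖c v‖ ≤ B := fun v => by
    refine (pi_norm_le_iff_of_nonneg B.2).2 fun i => ?_
    rw [Real.norm_eq_abs, abs_le]
    exact ⟨le_max_left _ _, max_le (by linarith [B.2]) (min_le_left _ _)⟩
  obtain ⟨C, hT⟩ : ∃ C, LipschitzWith C (WithLp.toLp 2 : (Fin n → ℝ) → E n) :=
    ⟨_, PiLp.lipschitzWith_toLp 2 (fun _ : Fin n => ℝ)⟩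
  refine ⟨fun x => WithLp.toLp 2 (c (G x)), _, C * B, hT.comp (hcl.comp hG), fun x => ?_,
    fun x hx => ?_⟩
  · have := hT.dist_le_mul (c (G x)) 0
    rw [WithLp.toLp_zero, dist_zero_right, dist_zero_right] at this
    rw [NNReal.coe_mul]
    exact this.trans (mul_le_mul_of_nonneg_left (hcn _) (NNReal.coe_nonneg _))
  · have hi : ∀ i, |F x i| ≤ B := fun i => (PiLp.norm_apply_le (F x) i).trans (hB x hx)
    ext i
    have h2 := congrFun (hFG hx) i
    simp only [Function.comp_def] at h2
    have := abs_le.1 (hi i)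
    simp only [hc, ← h2]
    rw [min_eq_right this.2, max_eq_right this.1]

theorem IsSolution.continuousOn {n : ℕ} {Ω : Set (E n)} {F : E n → E n} {x₀ : E n} {x : ℝ → E n}
    (hx : IsSolution Ω F x₀ x) : ContinuousOn x (Ici 0) :=
  fun t ht => (hx.2 t ht).2.continuousWithinAt

/-! ### Quadratic forms along perturbations of a linear field -/

/-- The derivative of the quadratic form of `N` along a field close to the linear field `B`. -/
theorem abs_inner_sub_le {n : ℕ} (N B : E n →L[ℝ] E n) {z v : E n} {η : ℝ}
    (hv : ‖v - B z‖ ≤ η * ‖z‖) :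
    |2 * inner ℝ (N z) v - 2 * inner ℝ (N z) (B z)| ≤ 2 * ‖N‖ * η * ‖z‖ ^ 2 := by
  rw [← mul_sub, ← inner_sub_right, abs_mul, abs_two]
  have h1 := abs_real_inner_le_norm (N z) (v - B z)
  have h2 : ‖N z‖ * ‖v - B z‖ ≤ (‖N‖ * ‖z‖) * (η * ‖z‖) :=
    mul_le_mul (N.le_opNorm z) hv (norm_nonneg _) (by positivity)
  nlinarith

/-- A Lyapunov stable equilibrium admits no quadratic form that is positive somewhere and
strictly increases along the linearized field. -/
theorem inner_nonpos_of_isAsymptoticallyStable {n : ℕ} {Ω : Set (E n)} {F : E n → E n}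
    {S B : E n →L[ℝ] E n} {c : ℝ} (hF : IsAsymptoticallyStable Ω F)
    (hlin : ∀ η > 0, ∃ ρ > 0, ∀ z, ‖z‖ < ρ → ‖F z - B z‖ ≤ η * ‖z‖)
    (hS : ∀ u v, inner ℝ u (S v) = inner ℝ (S u) v) (hc : 0 < c)
    (hpos : ∀ z, c * ‖z‖ ^ 2 ≤ 2 * inner ℝ (S z) (B z)) (z : E n) : inner ℝ z (S z) ≤ 0 := by
  by_contra! hz
  set s := ‖S‖ + 1 with hs
  have hs0 : 0 < s := by positivity
  have hSs : ‖S‖ ≤ s := by linarith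
  -- With this tolerance the nonlinearity costs at most half of the growth `c ‖z‖²`. The form then
  -- grows exponentially along the trajectory from a small multiple of `z`, while stability keeps it
  -- bounded.
  obtain ⟨ρ, hρ, hρF⟩ := hlin (c / (4 * s)) (by positivity)
  obtain ⟨η, hη, hst⟩ := hF.stable ρ hρ
  have hzne : z ≠ 0 := by rintro rfl; simp at hz
  have hzn : 0 < ‖z‖ := norm_pos_iff.2 hzne
  set a : ℝ := η / (2 * ‖z‖) with ha
  have ha0 : 0 < a := by positivity
  obtain ⟨⟨x, hx⟩, hall⟩ := hst (a • z) (by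
    rw [norm_smul, Real.norm_eq_abs, abs_of_pos ha0, ha]; field_simp; linarith)
  have hxρ := hall x hx
  set w : ℝ → ℝ := fun t => inner ℝ (x t) (S (x t)) with hw
  have hwle : ∀ t, w t ≤ s * ‖x t‖ ^ 2 := fun t => by
    have h1 := real_inner_le_norm (x t) (S (x t))
    have h2 := S.le_opNorm (x t)
    have h3 : ‖x t‖ * ‖S (x t)‖ ≤ ‖x t‖ * (s * ‖x t‖) := by gcongr; exact h2.trans (by gcongr)
    calc w t ≤ _ := h1
      _ ≤ _ := h3
      _ = _ := by ring
  have hd : ∀ t, 0 ≤ t → HasDerivWithinAt w (2 * inner ℝ (S (x t)) (F (x t))) (Ici 0) t :=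
    fun t ht => hasDerivWithinAt_inner_self hS (hx.2 t ht).2
  have hw0 : 0 < w 0 := by
    simp only [hw, hx.1, map_smul, inner_smul_left, inner_smul_right]
    simp only [conj_trivial]
    positivity
  have hgrow : ∀ t, 0 ≤ t → w 0 * Real.exp (c / (2 * s) * t) ≤ w t := by
    intro t ht
    have := le_mul_exp_of_hasDerivWithinAt_le (w := fun t => - w t) (b := -(c / (2 * s))) ht
      (fun u hu => ((hd u hu.1).neg.continuousWithinAt).mono Icc_subset_Ici_self)
      (fun u hu => (hd u hu.1).neg.mono (Ici_subset_Ici.2 hu.1)) ?_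
    · simp only [neg_neg, sub_zero] at this
      linarith
    · intro u hu
      have h1 := (abs_le.1 (abs_inner_sub_le S B (hρF (x u) (hxρ u hu.1)))).1
      have h2 := hpos (x u)
      have h3 : 2 * ‖S‖ * (c / (4 * s)) * ‖x u‖ ^ 2 ≤ 2 * s * (c / (4 * s)) * ‖x u‖ ^ 2 := by
        gcongr
      have h4 : 2 * s * (c / (4 * s)) = c / 2 := by field_simp; norm_num
      have h5 : c / (2 * s) * w u ≤ c / (2 * s) * (s * ‖x u‖ ^ 2) := by gcongr; exact hwle u
      have h6 : c / (2 * s) * (s * ‖x u‖ ^ 2) = c / 2 * ‖x u‖ ^ 2 := by field_simp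
      rw [h4] at h3
      simp only [neg_neg]
      linarith
  have hbd : ∀ t, 0 ≤ t → w t ≤ s * ρ ^ 2 := fun t ht =>
    (hwle t).trans (by gcongr; exact (hxρ t ht).le)
  have htend : Tendsto (fun t : ℝ => w 0 * Real.exp (c / (2 * s) * t)) atTop atTop :=
    (Real.tendsto_exp_atTop.comp (tendsto_id.const_mul_atTop (by positivity))).const_mul_atTop hw0
  obtain ⟨t, ht, ht0⟩ := ((htend.eventually_gt_atTop (s * ρ ^ 2)).and (eventually_ge_atTop 0)).exists
  linarith [hgrow t ht0, hbd t ht0]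

/-- A quadratic Lyapunov function of the linear field `B`. -/
structure IsLyapunovForm {n : ℕ} (N B : E n →L[ℝ] E n) (a c : ℝ) : Prop where
  symm : ∀ u v, inner ℝ u (N v) = inner ℝ (N u) v
  pos : 0 < a
  coercive : ∀ z, a * ‖z‖ ^ 2 ≤ inner ℝ z (N z)
  rate_pos : 0 < c
  decrease : ∀ z, 2 * inner ℝ (N z) (B z) ≤ - c * ‖z‖ ^ 2

/-- Trajectories of perturbations of `B` that stay near the origin decay exponentially. -/
theorem IsLyapunovForm.norm_le {n : ℕ} {N B : E n →L[ℝ] E n} {a c b : ℝ}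
    (h : IsLyapunovForm N B a c) (hb : ‖N‖ ≤ b) (hb0 : 0 < b) {y v : ℝ → E n} {t₀ t₁ : ℝ}
    (ht : t₀ ≤ t₁)
    (hc : ContinuousOn y (Icc t₀ t₁))
    (hd : ∀ t ∈ Ico t₀ t₁, HasDerivWithinAt y (v t) (Ici t) t)
    (hv : ∀ t ∈ Ico t₀ t₁, ‖v t - B (y t)‖ ≤ c / (4 * b) * ‖y t‖) :
    ‖y t₁‖ ≤ √(b / a) * ‖y t₀‖ * Real.exp (-(c / (4 * b)) * (t₁ - t₀)) := by
  have hcpos := h.rate_pos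
  have hapos := h.pos
  have hwle : ∀ t, inner ℝ (y t) (N (y t)) ≤ b * ‖y t‖ ^ 2 := fun t => by
    have h1 := real_inner_le_norm (y t) (N (y t))
    have h2 := N.le_opNorm (y t)
    have h3 : ‖y t‖ * ‖N (y t)‖ ≤ ‖y t‖ * (b * ‖y t‖) := by gcongr; exact h2.trans (by gcongr)
    calc _ ≤ _ := h1
      _ ≤ _ := h3
      _ = _ := by ring
  -- The perturbation uses up half of the decrease `c ‖y‖²`. As the form is at most `b ‖y‖²`, it
  -- decays at rate `c / (2b)`, and the norm at half that rate.
  have key := le_mul_exp_of_hasDerivWithinAt_le (w := fun t => inner ℝ (y t) (N (y t)))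
    (b := c / (2 * b)) ht (hc.inner (N.continuous.comp_continuousOn hc))
    (fun t ht => hasDerivWithinAt_inner_self h.symm (hd t ht)) ?_
  · have h1 : a * ‖y t₁‖ ^ 2 ≤ b * ‖y t₀‖ ^ 2 * Real.exp (-(c / (2 * b)) * (t₁ - t₀)) :=
      (h.coercive _).trans (key.trans (by gcongr; exact hwle _))
    have h2 : ‖y t₁‖ ^ 2 ≤ (√(b / a) * ‖y t₀‖ * Real.exp (-(c / (4 * b)) * (t₁ - t₀))) ^ 2 := by
      rw [mul_pow, mul_pow, Real.sq_sqrt (by positivity), ← Real.exp_nat_mul]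
      have e : ((2 : ℕ) : ℝ) * (-(c / (4 * b)) * (t₁ - t₀)) = -(c / (2 * b)) * (t₁ - t₀) := by
        push_cast; field_simp; ring
      rw [e, div_mul_eq_mul_div, div_mul_eq_mul_div, le_div_iff₀ hapos]
      linarith
    exact (pow_le_pow_iff_left₀ (norm_nonneg _) (by positivity) two_ne_zero).1 h2
  · intro t ht
    have h1 := (abs_le.1 (abs_inner_sub_le N B (hv t ht))).2
    have h2 := h.decrease (y t)
    have h3 : 2 * ‖N‖ * (c / (4 * b)) * ‖y t‖ ^ 2 ≤ 2 * b * (c / (4 * b)) * ‖y t‖ ^ 2 := by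
      gcongr
    have h4 : 2 * b * (c / (4 * b)) = c / 2 := by field_simp; norm_num
    have h5 : c / (2 * b) * inner ℝ (y t) (N (y t)) ≤ c / (2 * b) * (b * ‖y t‖ ^ 2) := by
      gcongr; exact hwle t
    have h6 : c / (2 * b) * (b * ‖y t‖ ^ 2) = c / 2 * ‖y t‖ ^ 2 := by field_simp
    rw [h4] at h3
    linarith

/-! ### The Lyapunov inequality for hyperbolic matrices, by convex separation -/

open scoped MatrixOrder ComplexOrder in
/-- A nonzero positive semidefinite solution of `B Y + Y Bᵀ = 0` forces an imaginary eigenvalue. -/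
theorem not_isHyperbolic_of_posSemidef {n : ℕ} {B Y : Matrix (Fin n) (Fin n) ℝ}
    (hY : Y.PosSemidef) (hY0 : Y ≠ 0) (hBY : B * Y + Y * Bᵀ = 0) : ¬ IsHyperbolic B := by
  intro hyp
  -- The factorization `Y = C* C` transfers positivity to the complexification.
  obtain ⟨C, hC⟩ := CStarAlgebra.nonneg_iff_eq_star_mul_self.1 hY.nonneg
  rw [Matrix.star_eq_conjTranspose] at hC
  set ι : ℝ →+* ℂ := algebraMap ℝ ℂ with hι
  have hstar : ∀ M : Matrix (Fin n) (Fin n) ℝ, (Mᵀ).map ι = (M.map ι)ᴴ := fun M => by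
    ext i j; simp [hι]
  set Bc := B.map ι with hBc
  set Yc := Y.map ι with hYc
  have hYpsd : Yc.PosSemidef := by
    have : Yc = (C.map ι)ᴴ * C.map ι := by
      rw [hYc, hC, Matrix.conjTranspose_eq_transpose_of_trivial, Matrix.map_mul, hstar]
    rw [this]
    exact Matrix.posSemidef_conjTranspose_mul_self _
  have hcomm : Bc * Yc = -(Yc * Bcᴴ) := by
    rw [← hstar, ← Matrix.map_mul, ← Matrix.map_mul, eq_neg_of_add_eq_zero_left hBY]
    ext i j
    rw [Matrix.map_apply, Matrix.neg_apply, Matrix.neg_apply, Matrix.map_apply, map_neg]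
  -- Since `B Y = -Y Bᵀ`, the range of `Y` is invariant under `B` and so contains an eigenvector `Y
  -- v`.
  set W : Submodule ℂ (Fin n → ℂ) := LinearMap.range (Matrix.toLin' Yc) with hW
  have hinv : ∀ w ∈ W, complexEnd B w ∈ W := by
    rintro _ ⟨v, rfl⟩
    refine ⟨-(Bcᴴ *ᵥ v), ?_⟩
    simp only [complexEnd, Matrix.toLin'_apply, ← hι, ← hBc]
    rw [Matrix.mulVec_mulVec, hcomm, Matrix.mulVec_neg, Matrix.mulVec_mulVec, Matrix.neg_mulVec]
  have hWne : Nontrivial W := by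
    rw [Submodule.nontrivial_iff_ne_bot]
    intro h
    have h0 : Yc = 0 := by
      rw [LinearMap.range_eq_bot] at h
      exact Matrix.toLin'.map_eq_zero_iff.1 h
    refine hY0 ?_
    ext i j
    have := congrFun (congrFun h0 i) j
    simpa [hYc, hι] using this
  obtain ⟨μ, hμ⟩ := Module.End.exists_eigenvalue ((complexEnd B).restrict hinv)
  obtain ⟨⟨w, hw⟩, hμw⟩ := hμ.exists_hasEigenvector
  have hw0 : w ≠ 0 := fun h => hμw.2 (Subtype.ext h)
  have hBw : Bc *ᵥ w = μ • w := by
    have := congrArg Subtype.val hμw.apply_eq_smul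
    simpa [complexEnd, hBc, hι] using this
  refine hyp μ (Module.End.hasEigenvalue_of_hasEigenvector
    ⟨Module.End.mem_eigenspace_iff.2 (by simpa [complexEnd, hBc, hι] using hBw), hw0⟩) ?_
  obtain ⟨v, rfl⟩ := hw
  rw [Matrix.toLin'_apply] at hBw hw0
  set s := star v ⬝ᵥ (Yc *ᵥ v) with hs
  have hs0 : s ≠ 0 := fun h => hw0 ((hYpsd.dotProduct_mulVec_zero_iff v).1 h)
  have hstar' : ∀ M : Matrix (Fin n) (Fin n) ℂ,
      star (star v ⬝ᵥ (M *ᵥ v)) = star v ⬝ᵥ (Mᴴ *ᵥ v) := fun M => by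
    rw [Matrix.star_dotProduct, star_star, Matrix.star_mulVec, ← Matrix.dotProduct_mulVec]
  have hss : star s = s := by rw [hs, hstar', hYpsd.1.eq]
  -- `B Y` is skew-Hermitian, so its form at `v` is imaginary; it equals `μ s` with `s = v* Y v`
  -- real and nonzero.
  have h1 : star v ⬝ᵥ ((Bc * Yc) *ᵥ v) = μ * s := by
    rw [← Matrix.mulVec_mulVec, hBw, dotProduct_smul, smul_eq_mul]
  have h2 : star (μ * s) = -(μ * s) := by
    rw [← h1, hstar', Matrix.conjTranspose_mul, hYpsd.1.eq, hcomm, Matrix.neg_mulVec,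
      dotProduct_neg, neg_neg]
  rw [star_mul, hss, mul_comm, ← neg_mul] at h2
  have h3 := congrArg Complex.re (mul_right_cancel₀ hs0 h2)
  simp at h3
  linarith

/-- Linear functionals on matrices are given by traces. -/
theorem exists_eq_trace_mul {n : ℕ} (φ : Matrix (Fin n) (Fin n) ℝ →ₗ[ℝ] ℝ) :
    ∃ Y : Matrix (Fin n) (Fin n) ℝ, ∀ M, φ M = (Y * M).trace := by
  refine ⟨Matrix.of fun i j => φ (Matrix.single j i 1), fun M => ?_⟩
  conv_lhs => rw [Matrix.matrix_eq_sum_single M]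
  simp only [map_sum, Matrix.trace, Matrix.diag, Matrix.mul_apply, Matrix.of_apply]
  rw [Finset.sum_comm]
  refine Finset.sum_congr rfl fun i _ => Finset.sum_congr rfl fun j _ => ?_
  have : Matrix.single j i (M j i) = M j i • Matrix.single j i (1 : ℝ) := by
    rw [Matrix.smul_single, smul_eq_mul, mul_one]
  rw [this, map_smul, smul_eq_mul, mul_comm]

/-- For a hyperbolic matrix the Lyapunov inequality `S B + Bᵀ S > 0` is solvable. -/
theorem exists_lyapunov_of_isHyperbolic {n : ℕ} {B : Matrix (Fin n) (Fin n) ℝ}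
    (hB : IsHyperbolic B) :
    ∃ (S : Matrix (Fin n) (Fin n) ℝ) (c : ℝ), S.IsSymm ∧ 0 < c ∧ ∀ z : E n, c * ‖z‖ ^ 2 ≤
      2 * inner ℝ (Matrix.toEuclideanCLM (𝕜 := ℝ) S z) (Matrix.toEuclideanCLM (𝕜 := ℝ) B z) := by
  let T (M : Matrix (Fin n) (Fin n) ℝ) : E n →L[ℝ] E n := Matrix.toEuclideanCLM (𝕜 := ℝ) M
  have hTinner : ∀ M N (z : E n), inner ℝ (T M z) (T N z) = inner ℝ z (T (Mᵀ * N) z) := by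
    intro M N z
    simp only [T]
    rw [Matrix.inner_toEuclideanCLM, Matrix.inner_toEuclideanCLM, ← Matrix.mulVec_mulVec,
      Matrix.dotProduct_mulVec z.ofLp, Matrix.vecMul_transpose]
    rfl
  set s : Set (Matrix (Fin n) (Fin n) ℝ) :=
    {M | ∃ c > 0, ∀ z : E n, c * ‖z‖ ^ 2 ≤ inner ℝ z (T M z)} with hs
  set Λ : Matrix (Fin n) (Fin n) ℝ →ₗ[ℝ] Matrix (Fin n) (Fin n) ℝ :=
    LinearMap.mulRight ℝ B + LinearMap.mulLeft ℝ Bᵀ with hΛ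
  have hΛa : ∀ S, Λ S = S * B + Bᵀ * S := fun S => rfl
  -- If some `S B + Bᵀ S` has a positive definite form, symmetrizing `S` finishes. Otherwise a
  -- separating functional yields a matrix `Y` that contradicts hyperbolicity.
  by_cases hdisj : Disjoint s (LinearMap.range Λ : Set (Matrix (Fin n) (Fin n) ℝ))
  swap
  · obtain ⟨_, ⟨c, hc, hM⟩, ⟨S, rfl⟩⟩ := Set.not_disjoint_iff.1 hdisj
    refine ⟨S + Sᵀ, 2 * c, by rw [Matrix.IsSymm, Matrix.transpose_add, Matrix.transpose_transpose,
      add_comm], by positivity, fun z => ?_⟩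
    have h1 := hM z
    have h2 : inner ℝ (T (S + Sᵀ) z) (T B z) = inner ℝ z (T (Λ S) z) := by
      have e : inner ℝ (T S z) (T B z) = inner ℝ z (T (Bᵀ * S) z) := by
        rw [real_inner_comm, hTinner]
      have e' : T (S + Sᵀ) = T S + T Sᵀ := map_add _ _ _
      have e'' : T (S * B + Bᵀ * S) = T (S * B) + T (Bᵀ * S) := map_add _ _ _
      rw [hΛa, e', e'', _root_.add_apply, inner_add_left, e, hTinner,
        Matrix.transpose_transpose, _root_.add_apply, inner_add_right, add_comm]
    change _ ≤ 2 * inner ℝ (T (S + Sᵀ) z) (T B z)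
    rw [h2]; linarith
  exfalso
  have hconv : Convex ℝ s := by
    rintro M ⟨c, hc, hM⟩ N ⟨d, hd, hN⟩ a b ha hb hab
    refine ⟨min c d, lt_min hc hd, fun z => ?_⟩
    have e : T (a • M + b • N) = a • T M + b • T N := by simp [T]
    rw [e]
    simp only [_root_.add_apply, _root_.smul_apply, inner_add_right,
      inner_smul_right]
    have h1 : min c d * ‖z‖ ^ 2 ≤ inner ℝ z (T M z) := le_trans (by gcongr; exact min_le_left _ _) (hM z)
    have h2 : min c d * ‖z‖ ^ 2 ≤ inner ℝ z (T N z) := le_trans (by gcongr; exact min_le_right _ _) (hN z)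
    calc min c d * ‖z‖ ^ 2 = a * (min c d * ‖z‖ ^ 2) + b * (min c d * ‖z‖ ^ 2) := by
          rw [← add_mul, hab, one_mul]
      _ ≤ _ := by gcongr
  have hopen : IsOpen s := by
    rw [Metric.isOpen_iff]
    rintro M ⟨c, hc, hM⟩
    refine ⟨c / 2, by positivity, fun N hN => ⟨c / 2, by positivity, fun z => ?_⟩⟩
    rw [Metric.mem_ball, dist_eq_norm] at hN
    have e : T N = T M + T (N - M) := by rw [← map_add, add_sub_cancel]
    rw [e, _root_.add_apply, inner_add_right]
    have h1 := (abs_le.1 (abs_real_inner_le_norm z (T (N - M) z))).1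
    have h2 : ‖T (N - M) z‖ ≤ ‖N - M‖ * ‖z‖ := (T (N - M)).le_opNorm z
    have h3 : ‖z‖ * ‖T (N - M) z‖ ≤ ‖z‖ * (c / 2 * ‖z‖) := by gcongr; exact h2.trans (by gcongr)
    have := hM z
    nlinarith
  obtain ⟨φ, u, hφs, hφt⟩ := geometric_hahn_banach_open hconv hopen
    (LinearMap.range Λ).convex hdisj
  have hu : u ≤ 0 := by simpa using hφt 0 (Submodule.zero_mem _)
  have hneg : ∀ M ∈ s, φ M < 0 := fun M hM => (hφs M hM).trans_le hu
  -- A functional bounded below on a subspace vanishes there: a nonzero value could be rescaled to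
  -- `u - 1`.
  have hzero : ∀ S, φ (Λ S) = 0 := by
    intro S
    by_contra h
    have := hφt (Λ (((u - 1) / φ (Λ S)) • S)) ⟨_, rfl⟩
    rw [map_smul, map_smul, smul_eq_mul, div_mul_cancel₀ _ h] at this
    linarith
  obtain ⟨Y, hY⟩ := exists_eq_trace_mul (-φ.toLinearMap)
  simp only [LinearMap.neg_apply, ContinuousLinearMap.coe_coe] at hY
  have hBY : B * Y + Y * Bᵀ = 0 := by
    refine Matrix.ext_iff_trace_mul_right.2 fun S => ?_
    have h := hY (Λ S)
    rw [hzero, hΛa, mul_add, Matrix.trace_add, ← mul_assoc, ← mul_assoc,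
      Matrix.trace_mul_comm (Y * S) B, ← mul_assoc] at h
    rw [add_mul, Matrix.trace_add, ← h]
    simp
  have hBY' : B * Yᵀ + Yᵀ * Bᵀ = 0 := by
    have := congrArg Matrix.transpose hBY
    simpa [Matrix.transpose_add, Matrix.transpose_mul, add_comm] using this
  have hone : (1 : Matrix (Fin n) (Fin n) ℝ) ∈ s :=
    ⟨1, one_pos, fun z => by simp [T]⟩
  have hform : ∀ x : Fin n → ℝ, 0 ≤ x ⬝ᵥ Y *ᵥ x := by
    intro x
    -- `x xᵀ` is only positive semidefinite, hence perhaps not in the open cone `s`; adding `ε • 1`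
    -- puts it there.
    have hx : ∀ ε > 0, φ (Matrix.vecMulVec x x) + ε * φ 1 < 0 := by
      intro ε hε
      have := hneg (Matrix.vecMulVec x x + ε • 1) ⟨ε, hε, fun z => ?_⟩
      · simpa using this
      · have e : T (Matrix.vecMulVec x x + ε • 1) = T (Matrix.vecMulVec x x) + ε • T 1 := by
          simp [T]
        have e1 : T 1 = 1 := map_one _
        have e2 : inner ℝ z (T (Matrix.vecMulVec x x) z) = (z.ofLp ⬝ᵥ x) ^ 2 := by
          simp only [T]
          rw [Matrix.inner_toEuclideanCLM, Matrix.vecMulVec_mulVec, dotProduct_comm x]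
          simp [dotProduct_smul, sq]
        rw [e, e1]
        simp only [_root_.add_apply, _root_.smul_apply,
          one_apply_eq_self, inner_add_right, inner_smul_right,
          real_inner_self_eq_norm_sq, e2]
        nlinarith [sq_nonneg (z.ofLp ⬝ᵥ x)]
    have h1 : x ⬝ᵥ Y *ᵥ x = - φ (Matrix.vecMulVec x x) := by
      rw [hY, Matrix.mul_vecMulVec, Matrix.trace_vecMulVec, dotProduct_comm]
    rw [h1]
    by_contra! h
    have h1' := hneg 1 hone
    have := hx (φ (Matrix.vecMulVec x x) / (-φ 1) ) (div_pos (by linarith) (by linarith))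
    have h2 : φ (Matrix.vecMulVec x x) / (-φ 1) * φ 1 = - φ (Matrix.vecMulVec x x) := by
      rw [div_neg, neg_mul, div_mul_cancel₀ _ h1'.ne]
    linarith
  refine not_isHyperbolic_of_posSemidef (Y := Y + Yᵀ) (B := B) ?_ ?_ ?_ hB
  · refine Matrix.PosSemidef.of_dotProduct_mulVec_nonneg ?_ fun x => ?_
    · simp [Matrix.IsHermitian, Matrix.conjTranspose_eq_transpose_of_trivial, add_comm]
    · have : x ⬝ᵥ Yᵀ *ᵥ x = x ⬝ᵥ Y *ᵥ x := by
        rw [Matrix.mulVec_transpose, dotProduct_comm, ← Matrix.dotProduct_mulVec]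
      rw [star_trivial, Matrix.add_mulVec, dotProduct_add, this]
      have := hform x
      linarith
  -- The trace of `Y` is `-φ 1 > 0`, so the symmetrized matrix is nonzero.
  · intro h
    have h1 := congrArg Matrix.trace h
    rw [Matrix.trace_add, Matrix.trace_transpose, Matrix.trace_zero] at h1
    have h2 := hY 1
    rw [mul_one] at h2
    linarith [hneg 1 hone]
  · rw [mul_add, add_mul, add_add_add_comm, hBY, hBY', add_zero]

/-! ### The Riccati equation and the linearized closed loop -/

theorem toEuclideanCLM_apply_eq_act {n : ℕ} (M : Matrix (Fin n) (Fin n) ℝ) (v : E n) :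
    Matrix.toEuclideanCLM (𝕜 := ℝ) M v = act M v := rfl

theorem norm_act_le {n : ℕ} (M : Matrix (Fin n) (Fin n) ℝ) (v : E n) :
    ‖act M v‖ ≤ ‖M‖ * ‖v‖ :=
  (Matrix.toEuclideanCLM (𝕜 := ℝ) M).le_opNorm v

theorem act_sub_left {n : ℕ} (M N : Matrix (Fin n) (Fin n) ℝ) (v : E n) :
    act (M - N) v = act M v - act N v := by
  simp only [← toEuclideanCLM_apply_eq_act, map_sub]
  rfl

theorem act_sub_right {n : ℕ} (M : Matrix (Fin n) (Fin n) ℝ) (v w : E n) :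
    act M (v - w) = act M v - act M w :=
  map_sub (Matrix.toEuclideanCLM (𝕜 := ℝ) M) v w

theorem act_smul_right {n : ℕ} (M : Matrix (Fin n) (Fin n) ℝ) (t : ℝ) (v : E n) :
    act M (t • v) = t • act M v :=
  map_smul (Matrix.toEuclideanCLM (𝕜 := ℝ) M) t v

theorem act_mul {n : ℕ} (M N : Matrix (Fin n) (Fin n) ℝ) (v : E n) :
    act (M * N) v = act M (act N v) := by
  simp [act]

theorem inner_act {n : ℕ} (x y : E n) (M : Matrix (Fin n) (Fin n) ℝ) :
    inner ℝ x (act M y) = x.ofLp ⬝ᵥ M *ᵥ y.ofLp :=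
  Matrix.inner_toEuclideanCLM M x y

theorem inner_act_transpose {n : ℕ} (x y : E n) (M : Matrix (Fin n) (Fin n) ℝ) :
    inner ℝ x (act M y) = inner ℝ (act Mᵀ x) y := by
  rw [real_inner_comm y, inner_act, inner_act, Matrix.mulVec_transpose, dotProduct_comm y.ofLp,
    Matrix.dotProduct_mulVec]

/-- A Hessian at a point is symmetric as soon as the gradient is differentiable there. -/
theorem isSymm_of_hasFDerivAt_gradient {n : ℕ} {V : E n → ℝ} {P : Matrix (Fin n) (Fin n) ℝ}
    {x : E n} (hV : ∀ᶠ y in 𝓝 x, DifferentiableAt ℝ V y)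
    (hP : HasFDerivAt (gradient V) (Matrix.toEuclideanCLM (𝕜 := ℝ) P) x) : P.IsSymm := by
  -- `L` turns gradients into differentials; symmetry of the second derivative then needs the
  -- differential near `x` but its derivative only at `x`.
  let L : E n →L[ℝ] (E n →L[ℝ] ℝ) := (innerₗ (E n)).mkContinuous₂ 1 fun x y => by
    simpa using abs_real_inner_le_norm x y
  have hL : ∀ u v, L u v = inner ℝ u v := fun u v => rfl
  have h1 : ∀ᶠ y in 𝓝 x, HasFDerivAt V (L (gradient V y)) y := by
    filter_upwards [hV] with y hy
    exact hy.hasGradientAt.hasFDerivAt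
  have h2 : HasFDerivAt (fun y => L (gradient V y))
      (L.comp (Matrix.toEuclideanCLM (𝕜 := ℝ) P)) x := L.hasFDerivAt.comp x hP
  have h3 := second_derivative_symmetric_of_eventually h1 h2
  ext i j
  have := h3 (EuclideanSpace.single i 1) (EuclideanSpace.single j 1)
  simp only [ContinuousLinearMap.comp_apply, hL] at this
  rw [toEuclideanCLM_apply_eq_act, toEuclideanCLM_apply_eq_act,
    real_inner_comm (EuclideanSpace.single j 1), real_inner_comm (EuclideanSpace.single i 1),
    inner_act, inner_act] at this
  simpa [Matrix.mulVec_single] using this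

/-- A symmetric matrix whose quadratic form vanishes is zero. -/
theorem eq_zero_of_isSymm_of_dotProduct_mulVec {n : ℕ} {M : Matrix (Fin n) (Fin n) ℝ}
    (hM : M.IsSymm) (h : ∀ x : E n, inner ℝ x (act M x) = 0) : M = 0 := by
  ext i j
  set x : E n := EuclideanSpace.single i 1
  set y : E n := EuclideanSpace.single j 1
  have h1 := h (x + y)
  have e : act M (x + y) = act M x + act M y := map_add (Matrix.toEuclideanCLM (𝕜 := ℝ) M) x y
  have e2 : inner ℝ y (act M x) = inner ℝ x (act M y) := by
    rw [inner_act_transpose, hM.eq, real_inner_comm]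
  rw [e, inner_add_left, inner_add_right, inner_add_right, h, h, e2] at h1
  have h3 : inner ℝ x (act M y) = 0 := by linarith
  rw [inner_act] at h3
  simpa [x, y, Matrix.mulVec_single] using h3

theorem controlMatrix_isSymm {n m : ℕ} (r : ℝ) (g : E n → Matrix (Fin n) (Fin m) ℝ) (x : E n) :
    (controlMatrix r g x).IsSymm := by
  simp [controlMatrix, Matrix.IsSymm, Matrix.transpose_smul, Matrix.transpose_mul]

theorem hasFDerivAt_zero_of_isBigO {n : ℕ} {f : E n → E n} {A : Matrix (Fin n) (Fin n) ℝ}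
    (hf : (fun x : E n => f x - act A x) =O[𝓝 0] (fun x : E n => ‖x‖ ^ 2)) :
    f 0 = 0 ∧ HasFDerivAt f (Matrix.toEuclideanCLM (𝕜 := ℝ) A) 0 := by
  have h0 : f 0 = 0 := by
    -- The filter `𝓝 0` includes the origin itself, where the bound `‖x‖ ^ 2` is zero.
    have := hf.eq_zero_imp.self_of_nhds (by simp)
    rwa [← toEuclideanCLM_apply_eq_act, map_zero, sub_zero] at this
  refine ⟨h0, HasFDerivAt.of_isLittleO ?_⟩
  have h1 : (fun x : E n => ‖x‖ ^ 2) =o[𝓝 0] (fun x : E n => x) :=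
    Asymptotics.isLittleO_norm_pow_id one_lt_two
  simpa [h0, toEuclideanCLM_apply_eq_act] using hf.trans_isLittleO h1

theorem continuousAt_controlMatrix {n m : ℕ} {r : ℝ} {g : E n → Matrix (Fin n) (Fin m) ℝ}
    {x : E n} (hg : ContinuousAt g x) : ContinuousAt (controlMatrix r g) x := by
  have h : Continuous fun M : Matrix (Fin n) (Fin m) ℝ => r⁻¹ • (M * Mᵀ) := by fun_prop
  exact h.continuousAt.comp hg

/-- The Hessian at the origin of a solution of the Hamilton-Jacobi equation solves the algebraic
Riccati equation. -/
theorem riccati_of_hamiltonJacobi {n : ℕ} {f p : E n → E n} {R : E n → Matrix (Fin n) (Fin n) ℝ}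
    {q : E n → ℝ} {A Q P : Matrix (Fin n) (Fin n) ℝ}
    (hf0 : f 0 = 0) (hf : HasFDerivAt f (Matrix.toEuclideanCLM (𝕜 := ℝ) A) 0)
    (hp0 : p 0 = 0) (hp : HasFDerivAt p (Matrix.toEuclideanCLM (𝕜 := ℝ) P) 0)
    (hq : (fun x : E n => q x - 1 / 2 * inner ℝ x (act Q x)) =O[𝓝 0] (fun x : E n => ‖x‖ ^ 3))
    (hR : ContinuousAt R 0) (hRs : (R 0).IsSymm) (hP : P.IsSymm) (hQ : Q.IsSymm)
    (hHJ : ∀ᶠ x in 𝓝 0,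
      inner ℝ (p x) (f x) - 1 / 2 * inner ℝ (p x) (act (R x) (p x)) + q x = 0) :
    P * A + Aᵀ * P - P * R 0 * P + Q = 0 := by
  refine eq_zero_of_isSymm_of_dotProduct_mulVec ?_ fun x => ?_
  · rw [Matrix.IsSymm]
    simp only [Matrix.transpose_add, Matrix.transpose_sub, Matrix.transpose_mul,
      Matrix.transpose_transpose, hP.eq, hQ.eq, hRs.eq, ← mul_assoc]
    rw [add_comm (Aᵀ * P)]
  -- The equation is evaluated at `t • x`, divided by `t²`, and passed to the limit `t → 0`; the
  -- limit is half the quadratic form of the Riccati residual.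
  have hline : Tendsto (fun t : ℝ => t • x) (𝓝[≠] 0) (𝓝 0) := by
    have : Continuous fun t : ℝ => t • x := by fun_prop
    simpa using (this.tendsto 0).mono_left nhdsWithin_le_nhds
  have hray : ∀ {h : E n → E n} {M : Matrix (Fin n) (Fin n) ℝ}, h 0 = 0 →
      HasFDerivAt h (Matrix.toEuclideanCLM (𝕜 := ℝ) M) 0 →
      Tendsto (fun t : ℝ => t⁻¹ • h (t • x)) (𝓝[≠] 0) (𝓝 (act M x)) := by
    intro h M h0 hh
    have := (hh.hasLineDerivAt x).tendsto_slope_zero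
    simpa [h0, toEuclideanCLM_apply_eq_act] using this
  have hf' := hray hf0 hf
  have hp' := hray hp0 hp
  have hR' : Tendsto (fun t : ℝ => act (R (t • x)) (t⁻¹ • p (t • x))) (𝓝[≠] 0)
      (𝓝 (act (R 0) (act P x))) := by
    have h1 : Tendsto (fun t : ℝ => R (t • x)) (𝓝[≠] 0) (𝓝 (R 0)) := hR.tendsto.comp hline
    have h2 : Continuous fun z : Matrix (Fin n) (Fin n) ℝ × E n => act z.1 z.2 := by
      unfold act
      fun_prop
    exact (h2.tendsto (R 0, act P x)).comp (h1.prodMk_nhds hp')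
  have hq' : Tendsto (fun t : ℝ => (t ^ 2)⁻¹ * q (t • x)) (𝓝[≠] 0)
      (𝓝 (1 / 2 * inner ℝ x (act Q x))) := by
    obtain ⟨C, hC⟩ := (hq.comp_tendsto hline).bound
    rw [tendsto_iff_norm_sub_tendsto_zero]
    refine squeeze_zero' (g := fun t : ℝ => C * ‖x‖ ^ 3 * |t|)
      (Eventually.of_forall fun _ => norm_nonneg _) ?_ ?_
    · filter_upwards [hC, self_mem_nhdsWithin] with t ht ht0
      have ht0' : t ≠ 0 := ht0
      simp only [Function.comp_def, act_smul_right, inner_smul_left, inner_smul_right,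
        conj_trivial, norm_smul, Real.norm_eq_abs] at ht
      have e : (t ^ 2)⁻¹ * q (t • x) - 1 / 2 * inner ℝ x (act Q x) =
          (t ^ 2)⁻¹ * (q (t • x) - 1 / 2 * (t * (t * inner ℝ x (act Q x)))) := by
        field_simp
      rw [e, Real.norm_eq_abs, abs_mul, abs_of_pos (by positivity : 0 < (t ^ 2)⁻¹),
        inv_mul_le_iff₀ (by positivity)]
      refine ht.trans (le_of_eq ?_)
      rw [abs_of_nonneg (by positivity : 0 ≤ (|t| * ‖x‖) ^ 3), ← sq_abs t]
      ring
    · have : Continuous fun t : ℝ => C * ‖x‖ ^ 3 * |t| := by fun_prop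
      simpa using (this.tendsto 0).mono_left nhdsWithin_le_nhds
  have hlim := ((hp'.inner hf').sub ((hp'.inner hR').const_mul (1 / 2))).add hq'
  have hzero : inner ℝ (act P x) (act A x) -
      1 / 2 * inner ℝ (act P x) (act (R 0) (act P x)) + 1 / 2 * inner ℝ x (act Q x) = 0 := by
    refine tendsto_nhds_unique (hlim.congr' ?_) tendsto_const_nhds
    filter_upwards [hline.eventually hHJ, self_mem_nhdsWithin] with t ht ht0
    have ht0' : t ≠ 0 := ht0
    simp only [act_smul_right, inner_smul_left, inner_smul_right, conj_trivial]
    have : q (t • x) = - (inner ℝ (p (t • x)) (f (t • x)) -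
        1 / 2 * inner ℝ (p (t • x)) (act (R (t • x)) (p (t • x)))) := by linarith
    rw [this]
    field_simp
    ring
  have e1 : inner ℝ x (act (P * A + Aᵀ * P - P * R 0 * P + Q) x) =
      inner ℝ x (act (P * A) x) + inner ℝ x (act (Aᵀ * P) x) - inner ℝ x (act (P * R 0 * P) x)
        + inner ℝ x (act Q x) := by
    simp only [inner_act, Matrix.add_mulVec, Matrix.sub_mulVec, dotProduct_add, dotProduct_sub]
  have e2 : inner ℝ x (act (P * A) x) = inner ℝ (act P x) (act A x) := by
    rw [act_mul, inner_act_transpose, hP.eq]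
  have e3 : inner ℝ x (act (Aᵀ * P) x) = inner ℝ (act P x) (act A x) := by
    rw [act_mul, inner_act_transpose, Matrix.transpose_transpose, real_inner_comm]
  have e4 : inner ℝ x (act (P * R 0 * P) x) = inner ℝ (act P x) (act (R 0) (act P x)) := by
    rw [mul_assoc, act_mul, act_mul, inner_act_transpose, hP.eq]
  rw [e1, e2, e3, e4]
  linarith

/-- The closed-loop matrix of a solution of the Riccati equation inherits hyperbolicity from the
Hamiltonian matrix. -/
theorem isHyperbolic_closedLoop_of_riccati {n : ℕ} {A R₀ Q P : Matrix (Fin n) (Fin n) ℝ}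
    (hH : IsHyperbolic (hamiltonianMatrix A R₀ Q))
    (hric : P * A + Aᵀ * P - P * R₀ * P + Q = 0) : IsHyperbolic (A - R₀ * P) := by
  intro μ hμ
  obtain ⟨v, hv⟩ := hμ.exists_hasEigenvector
  set ι : ℝ →+* ℂ := algebraMap ℝ ℂ with hι
  have hBv : (A - R₀ * P).map ι *ᵥ v = μ • v := hv.apply_eq_smul
  -- This is the Riccati equation read as invariance of the graph of `P` under the Hamiltonian
  -- matrix.
  have hric' : -Q + -Aᵀ * P = P * (A - R₀ * P) := by
    rw [mul_sub, ← mul_assoc, ← sub_eq_zero, ← neg_eq_zero, ← hric, neg_mul]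
    abel
  refine hH μ (Module.End.hasEigenvalue_of_hasEigenvector (x := Sum.elim v (P.map ι *ᵥ v))
    ⟨Module.End.mem_eigenspace_iff.2 ?_, fun h => hv.2 ?_⟩)
  · have h1 : A.map ι *ᵥ v + (-R₀).map ι *ᵥ (P.map ι *ᵥ v) = μ • v := by
      rw [← hBv, Matrix.mulVec_mulVec, ← Matrix.map_mul, ← Matrix.add_mulVec,
        ← Matrix.map_add _ (map_add ι), neg_mul, ← sub_eq_add_neg]
    have h2 : (-Q).map ι *ᵥ v + (-Aᵀ).map ι *ᵥ (P.map ι *ᵥ v) = μ • (P.map ι *ᵥ v) := by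
      rw [← Matrix.mulVec_smul, ← hBv, Matrix.mulVec_mulVec, Matrix.mulVec_mulVec,
        ← Matrix.map_mul, ← Matrix.map_mul, ← Matrix.add_mulVec, ← Matrix.map_add _ (map_add ι),
        hric']
    simp only [complexEnd, Matrix.toLin'_apply, hamiltonianMatrix, ← hι]
    rw [Matrix.fromBlocks_map, Matrix.fromBlocks_mulVec]
    simp only [Sum.elim_comp_inl, Sum.elim_comp_inr]
    rw [h1, h2]
    ext (i | i) <;> rfl
  · ext i
    exact congrFun h (Sum.inl i)

/-- Feedback laws that are close to the linear law `P z` near the origin give closed-loop fields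
that are close to the linear closed-loop field. -/
theorem exists_closedLoop_sub_le {n : ℕ} {f : E n → E n} {R : E n → Matrix (Fin n) (Fin n) ℝ}
    {A P : Matrix (Fin n) (Fin n) ℝ} (hf0 : f 0 = 0)
    (hf : HasFDerivAt f (Matrix.toEuclideanCLM (𝕜 := ℝ) A) 0) (hR : ContinuousAt R 0)
    {η : ℝ} (hη : 0 < η) :
    ∃ ρ > 0, ∃ κ > 0, ∀ z u : E n, ‖z‖ < ρ → ‖u - act P z‖ ≤ κ * ‖z‖ →
      ‖f z - act (R z) u - Matrix.toEuclideanCLM (𝕜 := ℝ) (A - R 0 * P) z‖ ≤ η * ‖z‖ := by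
  set b := ‖R 0‖ + 1 with hb
  set d := ‖P‖ + 1 with hd
  have hb0 : 0 < b := by positivity
  have hd0 : 0 < d := by positivity
  have h1 : ∀ᶠ z in 𝓝 (0 : E n), ‖f z - act A z‖ ≤ η / 3 * ‖z‖ := by
    have := hf.isLittleO.bound (show 0 < η / 3 by positivity)
    simpa [hf0, toEuclideanCLM_apply_eq_act] using this
  have h2 : ∀ᶠ z in 𝓝 (0 : E n), ‖R z - R 0‖ < min 1 (η / (3 * d)) := by
    have := Metric.continuousAt_iff'.1 hR (min 1 (η / (3 * d))) (lt_min one_pos (by positivity))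
    simpa [dist_eq_norm] using this
  obtain ⟨ρ, hρ, hball⟩ := Metric.eventually_nhds_iff.1 (h1.and h2)
  refine ⟨ρ, hρ, η / (3 * b), by positivity, fun z u hz hu => ?_⟩
  obtain ⟨hfz, hRz⟩ := hball (y := z) (by simpa using hz)
  have hRb : ‖R z‖ ≤ b := by
    have h3 := norm_add_le (R z - R 0) (R 0)
    rw [sub_add_cancel] at h3
    linarith [hRz.trans_le (min_le_left _ _)]
  have hRd : ‖R z - R 0‖ ≤ η / (3 * d) := (hRz.trans_le (min_le_right _ _)).le
  -- Three errors, each at most `η / 3 * ‖z‖`: the nonlinearity of `f`, the deviation of the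
  -- feedback from `P z`, and the variation of `R`.
  have e : f z - act (R z) u - Matrix.toEuclideanCLM (𝕜 := ℝ) (A - R 0 * P) z =
      (f z - act A z) - act (R z) (u - act P z) - act (R z - R 0) (act P z) := by
    rw [toEuclideanCLM_apply_eq_act, act_sub_left, act_sub_left, act_sub_right, act_mul]
    abel
  have h4 : ‖act (R z) (u - act P z)‖ ≤ η / 3 * ‖z‖ := by
    calc _ ≤ ‖R z‖ * ‖u - act P z‖ := norm_act_le _ _
      _ ≤ b * (η / (3 * b) * ‖z‖) := by gcongr
      _ = _ := by field_simp
  have h5 : ‖act (R z - R 0) (act P z)‖ ≤ η / 3 * ‖z‖ := by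
    calc _ ≤ ‖R z - R 0‖ * ‖act P z‖ := norm_act_le _ _
      _ ≤ η / (3 * d) * (d * ‖z‖) := by
          gcongr
          exact (norm_act_le _ _).trans (by gcongr; linarith)
      _ = _ := by field_simp
  rw [e]
  calc _ ≤ ‖f z - act A z‖ + ‖act (R z) (u - act P z)‖ + ‖act (R z - R 0) (act P z)‖ :=
        (norm_sub_le _ _).trans (by gcongr; exact norm_sub_le _ _)
    _ ≤ η * ‖z‖ := by linarith

/-- A Lyapunov stable field with hyperbolic linearization has a quadratic Lyapunov function. -/
theorem exists_isLyapunovForm {n : ℕ} {Ω : Set (E n)} {F : E n → E n}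
    {B : Matrix (Fin n) (Fin n) ℝ} (hF : IsAsymptoticallyStable Ω F) (hB : IsHyperbolic B)
    (hlin : ∀ η > 0, ∃ ρ > 0, ∀ z, ‖z‖ < ρ →
      ‖F z - Matrix.toEuclideanCLM (𝕜 := ℝ) B z‖ ≤ η * ‖z‖) :
    ∃ N a c, IsLyapunovForm N (Matrix.toEuclideanCLM (𝕜 := ℝ) B) a c := by
  obtain ⟨S, c, hS, hc, hpos⟩ := exists_lyapunov_of_isHyperbolic hB
  set T : E n →L[ℝ] E n := Matrix.toEuclideanCLM (𝕜 := ℝ) S with hT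
  set L : E n →L[ℝ] E n := Matrix.toEuclideanCLM (𝕜 := ℝ) B with hL
  have hTs : ∀ u v, inner ℝ u (T v) = inner ℝ (T u) v := fun u v => by
    simp only [hT, toEuclideanCLM_apply_eq_act]
    rw [inner_act_transpose, hS.eq]
  -- The shift `T + ε` still increases along `L`, at rate `c / 2`. Nonpositivity of the shifted form
  -- is coercivity of `-T` with constant `ε`, which nonpositivity of `T` alone would not give.
  set ε := c / (4 * (‖L‖ + 1)) with hε
  have hε0 : 0 < ε := by positivity
  set T' : E n →L[ℝ] E n := T + ε • ContinuousLinearMap.id ℝ (E n) with hT'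
  have hT'a : ∀ z, T' z = T z + ε • z := fun z => rfl
  have hT's : ∀ u v, inner ℝ u (T' v) = inner ℝ (T' u) v := fun u v => by
    simp only [hT'a, inner_add_right, inner_add_left, hTs, inner_smul_left, inner_smul_right,
      conj_trivial]
  have hpos' : ∀ z, c / 2 * ‖z‖ ^ 2 ≤ 2 * inner ℝ (T' z) (L z) := fun z => by
    rw [hT'a, inner_add_left, inner_smul_left, conj_trivial]
    have h1 := hpos z
    have h2 := (abs_le.1 (abs_real_inner_le_norm z (L z))).1
    have h3 : ε * (‖z‖ * ‖L z‖) ≤ ε * (‖z‖ * ((‖L‖ + 1) * ‖z‖)) := by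
      gcongr
      exact (L.le_opNorm z).trans (by gcongr; linarith)
    have h4 : ε * (‖z‖ * ((‖L‖ + 1) * ‖z‖)) = c / 4 * ‖z‖ ^ 2 := by
      rw [hε]; field_simp
    have h5 : -(ε * (‖z‖ * ‖L z‖)) ≤ ε * inner ℝ z (L z) := by
      rw [← mul_neg]; gcongr
    change c / 2 * ‖z‖ ^ 2 ≤ 2 * (inner ℝ (T z) (L z) + ε * inner ℝ z (L z))
    linarith
  have hnonpos := inner_nonpos_of_isAsymptoticallyStable hF hlin hT's (half_pos hc) hpos'
  refine ⟨-T, ε, c, ⟨fun u v => by simp [hTs], hε0, fun z => ?_, hc, fun z => ?_⟩⟩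
  · have := hnonpos z
    rw [hT'a, inner_add_right, inner_smul_right, real_inner_self_eq_norm_sq] at this
    rw [neg_apply, inner_neg_right]
    linarith
  · rw [neg_apply, inner_neg_left]
    have := hpos z
    linarith

/-! ### Trajectory estimates that also prove confinement to `Ω` -/

/-- Gronwall comparison with a trajectory that keeps a positive distance from the complement
of `Ω`; the comparison curve need not be known to stay in `Ω`. -/
theorem norm_sub_le_gronwallBound_of_tube {n : ℕ} {Ω : Set (E n)} {F G : E n → E n} {K : ℝ≥0}
    {e T ρ : ℝ} {x y : ℝ → E n} (hF : LipschitzOnWith K F Ω) (he : 0 ≤ e)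
    (hG : ∀ z ∈ Ω, ‖G z - F z‖ ≤ e)
    (hxc : ContinuousOn x (Icc 0 T))
    (hxd : ∀ t ∈ Ico 0 T, HasDerivWithinAt x (F (x t)) (Ici t) t)
    (htube : ∀ t ∈ Icc 0 T, ∀ z, ‖z - x t‖ < ρ → z ∈ Ω)
    (hyc : ContinuousOn y (Ici 0)) (hxy : y 0 = x 0)
    (hyd : ∀ t, 0 ≤ t → y t ∈ Ω → HasDerivWithinAt y (G (y t)) (Ici t) t)
    (hρ : gronwallBound 0 K e T < ρ) :
    ∀ t ∈ Icc 0 T, y t ∈ Ω ∧ ‖y t - x t‖ ≤ gronwallBound 0 K e t := by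
  have hmono := gronwallBound_mono le_rfl he K.2
  have hstep : ∀ t ∈ Icc 0 T, (∀ s ∈ Ico 0 t, ‖y s - x s‖ < ρ) →
      ‖y t - x t‖ ≤ gronwallBound 0 K e t := by
    intro t ht hs
    have hsub : Ico 0 t ⊆ Ico 0 T := Ico_subset_Ico_right ht.2
    have hyΩ : ∀ s ∈ Ico 0 t, y s ∈ Ω := fun s hs' =>
      htube s (Ico_subset_Icc_self (hsub hs')) _ (hs s hs')
    have hρ0 : 0 < ρ := lt_of_le_of_lt (by
      have := hmono (ht.1.trans ht.2)
      rwa [gronwallBound_x0] at this) hρ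
    have h := dist_le_of_approx_trajectories_ODE_of_mem (v := fun _ => F) (s := fun _ => Ω)
      (K := K) (a := 0) (b := t) (f := y) (g := x) (εf := e) (εg := 0) (δ := 0)
      (fun _ _ => hF) (hyc.mono Icc_subset_Ici_self)
      (fun s hs' => hyd s hs'.1 (hyΩ s hs')) (fun s hs' => by
        rw [dist_eq_norm]; exact hG _ (hyΩ s hs')) hyΩ
      (hxc.mono (Icc_subset_Icc_right ht.2)) (fun s hs' => hxd s (hsub hs'))
      (fun s _ => by rw [dist_self])
      (fun s hs' => htube s (Ico_subset_Icc_self (hsub hs')) _ (by simpa using hρ0))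
      (by rw [hxy, dist_self]) t ⟨ht.1, le_rfl⟩
    rwa [dist_eq_norm, add_zero, sub_zero] at h
  -- Bootstrap: as long as `y` is in the tube it is in `Ω`, so Gronwall applies and gives a bound
  -- strictly below the tube radius.
  have hclose : ∀ t, 0 ≤ t → t ≤ T → ‖y t - x t‖ < ρ := by
    refine forall_ge_of_forall_Ico (fun t ht hs htT => ?_) (fun t ht hPt => ?_)
    · exact (hstep t ⟨ht, htT⟩ fun s hs' => hs s hs' (hs'.2.le.trans htT)).trans_lt
        ((hmono htT).trans_lt hρ)
    · rcases lt_or_ge t T with htT | htT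
      · have hc : ContinuousWithinAt (fun s => ‖y s - x s‖) (Icc 0 T) t :=
          (((hyc.mono Icc_subset_Ici_self).sub hxc).norm) t ⟨ht, htT.le⟩
        have hc' : Tendsto (fun s => ‖y s - x s‖) (𝓝[>] t) (𝓝 ‖y t - x t‖) :=
          hc.mono_left (nhdsWithin_le_iff.2 (mem_of_superset (Ioc_mem_nhdsGT htT)
            (Ioc_subset_Icc_self.trans (Icc_subset_Icc_left ht))))
        filter_upwards [hc'.eventually_lt_const (hPt htT.le)] with s hs _ using hs
      · filter_upwards [self_mem_nhdsWithin] with s hs hsT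
        exact absurd (htT.trans_lt hs) (not_lt.2 hsT)
  intro t ht
  exact ⟨htube t ht _ (hclose t ht.1 ht.2),
    hstep t ht fun s hs => hclose s hs.1 (hs.2.le.trans ht.2)⟩

/-- Exponential decay near the origin; the trajectory need not be known to stay in `Ω`. -/
theorem IsLyapunovForm.norm_le_of_ball {n : ℕ} {N B : E n →L[ℝ] E n} {a c b ρ : ℝ}
    (h : IsLyapunovForm N B a c) (hb : ‖N‖ ≤ b) (hb0 : 0 < b) {Ω : Set (E n)} {G : E n → E n}
    (hG : ∀ z, ‖z‖ < ρ → z ∈ Ω ∧ ‖G z - B z‖ ≤ c / (4 * b) * ‖z‖) {y : ℝ → E n} {t₀ : ℝ}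
    (hyc : ContinuousOn y (Ici t₀))
    (hyd : ∀ t, t₀ ≤ t → y t ∈ Ω → HasDerivWithinAt y (G (y t)) (Ici t) t)
    (hstart : (√(b / a) + 1) * ‖y t₀‖ < ρ) {t : ℝ} (ht : t₀ ≤ t) :
    y t ∈ Ω ∧ ‖y t‖ ≤ (√(b / a) + 1) * ‖y t₀‖ * Real.exp (-(c / (4 * b)) * (t - t₀)) := by
  have hcpos := h.rate_pos
  have hstep : ∀ t, t₀ ≤ t → (∀ s ∈ Ico t₀ t, ‖y s‖ < ρ) →
      ‖y t‖ ≤ (√(b / a) + 1) * ‖y t₀‖ * Real.exp (-(c / (4 * b)) * (t - t₀)) := by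
    intro t ht hs
    refine (h.norm_le hb hb0 ht (hyc.mono Icc_subset_Ici_self)
      (fun s hs' => hyd s hs'.1 (hG _ (hs s hs')).1) (fun s hs' => (hG _ (hs s hs')).2)).trans ?_
    gcongr
    linarith
  have hsmall : ∀ t, t₀ ≤ t → ‖y t‖ < ρ := by
    refine forall_ge_of_forall_Ico (fun t ht hs => ?_) (fun t ht hPt => ?_)
    · refine (hstep t ht hs).trans_lt (lt_of_le_of_lt ?_ hstart)
      refine mul_le_of_le_one_right (by positivity) (Real.exp_le_one_iff.2 ?_)
      have : 0 ≤ c / (4 * b) * (t - t₀) := mul_nonneg (by positivity) (by linarith)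
      linarith
    · have hc : Tendsto (fun s => ‖y s‖) (𝓝[>] t) (𝓝 ‖y t‖) :=
        (hyc.norm t ht).mono_left (nhdsWithin_mono _ (Ioi_subset_Ici ht))
      exact hc.eventually_lt_const hPt
  exact ⟨(hG _ (hsmall t ht)).1, hstep t ht fun s hs => hsmall s hs.1⟩

theorem IsSolution.hasDerivWithinAt_Ici {n : ℕ} {Ω : Set (E n)} {F : E n → E n} {x₀ : E n}
    {x : ℝ → E n} (hx : IsSolution Ω F x₀ x) {t : ℝ} (ht : 0 ≤ t) :
    HasDerivWithinAt x (F (x t)) (Ici t) t :=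
  (hx.2 t ht).2.mono (Ici_subset_Ici.2 ht)

/-- Solutions that tend to the origin do so exponentially. -/
theorem IsLyapunovForm.exists_norm_le_exp {n : ℕ} {N B : E n →L[ℝ] E n} {a c b ρ : ℝ}
    (h : IsLyapunovForm N B a c) (hb : ‖N‖ ≤ b) (hb0 : 0 < b) (hρ : 0 < ρ) {Ω : Set (E n)}
    {F : E n → E n}
    (hF : ∀ z, ‖z‖ < ρ → z ∈ Ω ∧ ‖F z - B z‖ ≤ c / (4 * b) * ‖z‖) {x₀ : E n} {x : ℝ → E n}
    (hx : IsSolution Ω F x₀ x) (hx0 : Tendsto x atTop (𝓝 0)) :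
    ∃ C > 0, ∀ t, 0 ≤ t → ‖x t‖ ≤ C * Real.exp (-(c / (4 * b)) * t) := by
  have hcpos := h.rate_pos
  set β := c / (4 * b) with hβ
  set κ := √(b / a) + 1 with hκ
  have hκ0 : 0 < κ := by positivity
  have hev : ∀ᶠ t in atTop, ‖x t‖ < ρ / κ := by
    have := hx0.norm
    rw [norm_zero] at this
    exact this.eventually_lt_const (by positivity)
  obtain ⟨t₁, ht₁, ht₁0⟩ := (hev.and (eventually_ge_atTop 0)).exists
  obtain ⟨D, hD⟩ := isCompact_Icc.exists_bound_of_continuousOn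
    (hx.continuousOn.mono (Icc_subset_Ici_self : Icc 0 t₁ ⊆ Ici 0))
  set D' := max D 1 with hD'
  have hD1 : 1 ≤ D' := le_max_right _ _
  -- The decay starts at `t₁`, once `x` is within `ρ / κ` of the origin; the factor `exp (β t₁)`
  -- absorbs the compact interval before.
  refine ⟨κ * D' * Real.exp (β * t₁), by positivity, fun t ht => ?_⟩
  rw [mul_assoc, ← Real.exp_add]
  rcases le_total t t₁ with htt | htt
  · have h1 : ‖x t‖ ≤ D' := (hD t ⟨ht, htt⟩).trans (le_max_left _ _)
    have h2 : 1 ≤ Real.exp (β * t₁ + -β * t) := by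
      rw [Real.one_le_exp_iff]
      have : 0 ≤ β * (t₁ - t) := mul_nonneg (by positivity) (by linarith)
      linarith
    have h3 : 1 ≤ κ := by rw [hκ]; linarith [Real.sqrt_nonneg (b / a)]
    calc ‖x t‖ ≤ 1 * D' * 1 := by linarith
      _ ≤ _ := by gcongr
  · have h1 := (h.norm_le_of_ball hb hb0 hF (hx.continuousOn.mono (Ici_subset_Ici.2 ht₁0))
      (fun s hs _ => hx.hasDerivWithinAt_Ici (ht₁0.trans hs))
      (by rw [← hκ, mul_comm]; exact (lt_div_iff₀ hκ0).1 ht₁) htt).2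
    have h2 : ‖x t₁‖ ≤ D' := (hD t₁ ⟨ht₁0, le_rfl⟩).trans (le_max_left _ _)
    have e : -β * (t - t₁) = β * t₁ + -β * t := by ring
    rw [e] at h1
    exact h1.trans (by gcongr)

/-! ### Lipschitz bounds for the closed loop and the networks -/

theorem LipschitzOnWith.exists_norm_le {X Y : Type*} [PseudoMetricSpace X]
    [SeminormedAddCommGroup Y] {s : Set X} {u : X → Y} {K : ℝ≥0} (hu : LipschitzOnWith K u s)
    (hs : Bornology.IsBounded s) : ∃ b : ℝ≥0, ∀ x ∈ s, ‖u x‖ ≤ b := by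
  rcases s.eq_empty_or_nonempty with rfl | ⟨a, ha⟩
  · exact ⟨0, by simp⟩
  refine ⟨‖u a‖₊ + K * (Metric.diam s).toNNReal, fun x hx => ?_⟩
  have h1 := hu.dist_le_mul x hx a ha
  have h2 := Metric.dist_le_diam_of_mem hs hx ha
  have h3 := norm_le_norm_add_norm_sub' (u x) (u a)
  rw [← dist_eq_norm] at h3
  push_cast
  rw [Real.coe_toNNReal _ Metric.diam_nonneg]
  have : (K : ℝ) * dist x a ≤ K * Metric.diam s := by gcongr
  linarith

theorem exists_norm_controlMatrix_le {n m : ℕ} {Ω : Set (E n)} (r : ℝ)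
    {g : E n → Matrix (Fin n) (Fin m) ℝ} {K : ℝ≥0} (hg : LipschitzOnWith K g Ω)
    (hΩ : Bornology.IsBounded Ω) : ∃ b : ℝ≥0, ∀ x ∈ Ω, ‖controlMatrix r g x‖ ≤ b := by
  obtain ⟨b, hb⟩ := hg.exists_norm_le hΩ
  refine ⟨‖r⁻¹‖₊ * (b * b), fun x hx => ?_⟩
  unfold controlMatrix
  rw [norm_smul, NNReal.coe_mul, coe_nnnorm, NNReal.coe_mul]
  have h1 := Matrix.l2_opNorm_mul (g x) (g x)ᵀ
  have h2 : ‖(g x)ᵀ‖ = ‖g x‖ := by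
    rw [← Matrix.conjTranspose_eq_transpose_of_trivial, Matrix.l2_opNorm_conjTranspose]
  rw [h2] at h1
  have := hb x hx
  gcongr
  exact h1.trans (by gcongr)

/-- The product `R p` is Lipschitz because both factors are also bounded. With `p = ∇V` this
supplies the Gronwall constant; with a network it serves only existence. -/
theorem lipschitzOnWith_closedLoop {n m : ℕ} {Ω : Set (E n)} {f p : E n → E n}
    {g : E n → Matrix (Fin n) (Fin m) ℝ} {r : ℝ} {Kf KR Kp bR bp : ℝ≥0}
    (hf : LipschitzOnWith Kf f Ω) (hR : LipschitzOnWith KR (controlMatrix r g) Ω)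
    (hp : LipschitzOnWith Kp p Ω) (hbR : ∀ x ∈ Ω, ‖controlMatrix r g x‖ ≤ bR)
    (hbp : ∀ x ∈ Ω, ‖p x‖ ≤ bp) :
    LipschitzOnWith (Kf + bR * Kp + KR * bp) (closedLoop f g r p) Ω := by
  refine LipschitzOnWith.of_dist_le_mul fun x hx y hy => ?_
  have h1 := hf.dist_le_mul x hx y hy
  have h2 := hR.dist_le_mul x hx y hy
  have h3 := hp.dist_le_mul x hx y hy
  simp only [dist_eq_norm] at h1 h2 h3 ⊢
  have e : closedLoop f g r p x - closedLoop f g r p y = (f x - f y)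
      - act (controlMatrix r g x) (p x - p y)
      - act (controlMatrix r g x - controlMatrix r g y) (p y) := by
    unfold closedLoop
    rw [act_sub_left, act_sub_right]
    abel
  have h4 : ‖act (controlMatrix r g x) (p x - p y)‖ ≤ bR * (Kp * ‖x - y‖) :=
    (norm_act_le _ _).trans (by gcongr; exact hbR x hx)
  have h5 : ‖act (controlMatrix r g x - controlMatrix r g y) (p y)‖ ≤ KR * ‖x - y‖ * bp :=
    (norm_act_le _ _).trans (by gcongr; exact hbp y hy)
  rw [e]
  calc _ ≤ ‖f x - f y‖ + ‖act (controlMatrix r g x) (p x - p y)‖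
        + ‖act (controlMatrix r g x - controlMatrix r g y) (p y)‖ :=
        (norm_sub_le _ _).trans (by gcongr; exact norm_sub_le _ _)
    _ ≤ _ := by push_cast; linarith

theorem contDiff_mulVec {k l : ℕ} {X : Type*} [NormedAddCommGroup X] [NormedSpace ℝ X]
    (W : Matrix (Fin k) (Fin l) ℝ) {S : X → Fin l → ℝ} (hS : ContDiff ℝ 1 S) :
    ContDiff ℝ 1 fun x => W *ᵥ S x :=
  (LinearMap.toContinuousLinearMap W.mulVecLin).contDiff.comp hS

theorem contDiff_sinAct {l : ℕ} {X : Type*} [NormedAddCommGroup X] [NormedSpace ℝ X]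
    {S : X → Fin l → ℝ} (hS : ContDiff ℝ 1 S) : ContDiff ℝ 1 fun x => sinAct (S x) :=
  contDiff_pi.2 fun j => Real.contDiff_sin.comp (contDiff_pi.1 hS j)

theorem contDiff_ofLp {n : ℕ} : ContDiff ℝ 1 fun x : E n => x.ofLp :=
  (PiLp.continuousLinearEquiv 2 ℝ fun _ : Fin n => ℝ).contDiff

theorem Gate.contDiff_eval {n M : ℕ} (a : Gate n M) {S : E n → Fin M → ℝ}
    (hS : ContDiff ℝ 1 S) : ContDiff ℝ 1 fun x : E n => a.eval x.ofLp (S x) :=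
  contDiff_sinAct (((contDiff_mulVec _ contDiff_ofLp).add (contDiff_mulVec _ hS)).add
    contDiff_const)

theorem Layer.contDiff_step {n M : ℕ} (a : Layer n M) {S : E n → Fin M → ℝ}
    (hS : ContDiff ℝ 1 S) : ContDiff ℝ 1 fun x : E n => a.step x.ofLp (S x) :=
  ((contDiff_const.sub (a.gG.contDiff_eval hS)).mul
    (a.gH.contDiff_eval (hS.mul (a.gR.contDiff_eval hS)))).add ((a.gZ.contDiff_eval hS).mul hS)

theorem contDiff_foldl_step {n M : ℕ} (l : List (Layer n M)) :
    ∀ {S : E n → Fin M → ℝ}, ContDiff ℝ 1 S →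
      ContDiff ℝ 1 fun x : E n => l.foldl (fun S a => a.step x.ofLp S) (S x) := by
  induction l with
  | nil => exact fun hS => hS
  | cons a l ih => exact fun hS => ih (a.contDiff_step hS)

theorem NNParams.contDiff_eval {n M : ℕ} (θ : NNParams n M) : ContDiff ℝ 1 θ.eval :=
  (PiLp.continuousLinearEquiv 2 ℝ fun _ : Fin n => ℝ).symm.contDiff.comp
    ((contDiff_mulVec _ (contDiff_foldl_step _ (contDiff_sinAct
      ((contDiff_mulVec _ contDiff_ofLp).add contDiff_const)))).add contDiff_const)

theorem NNParams.exists_lipschitzOnWith_eval {n M : ℕ} (θ : NNParams n M) {Ω : Set (E n)}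
    (hΩ : Bornology.IsBounded Ω) : ∃ K : ℝ≥0, LipschitzOnWith K θ.eval Ω := by
  obtain ⟨R, hR⟩ := hΩ.subset_closedBall 0
  obtain ⟨K, hK⟩ := θ.contDiff_eval.contDiffOn.exists_lipschitzOnWith one_ne_zero
    (convex_closedBall (0 : E n) R) (isCompact_closedBall 0 R)
  exact ⟨K, hK.mono hR⟩

/-- A Lipschitz field on a bounded set whose extended trajectories never leave the set has a
global solution. -/
theorem exists_isSolution {n : ℕ} {Ω : Set (E n)} {G : E n → E n} {K : ℝ≥0}
    (hΩ : Bornology.IsBounded Ω) (hG : LipschitzOnWith K G Ω) {x₀ : E n}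
    (hstay : ∀ y : ℝ → E n, ContinuousOn y (Ici 0) → y 0 = x₀ →
      (∀ t, 0 ≤ t → y t ∈ Ω → HasDerivWithinAt y (G (y t)) (Ici t) t) →
      ∀ t, 0 ≤ t → y t ∈ Ω) :
    ∃ y, IsSolution Ω G x₀ y := by
  obtain ⟨b, hb⟩ := hG.exists_norm_le hΩ
  obtain ⟨H, K', b', hH, hHb, hGH⟩ := exists_bounded_lipschitz_extension hG hb
  obtain ⟨y, hy0, hy⟩ := exists_solution_of_bounded_lipschitz hH hHb x₀
  have hmem := hstay y (fun t ht => (hy t ht).continuousWithinAt) hy0 fun t ht hyt => by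
    rw [hGH hyt]
    exact (hy t ht).mono (Ici_subset_Ici.2 ht)
  refine ⟨y, hy0, fun t ht => ⟨hmem t ht, ?_⟩⟩
  rw [hGH (hmem t ht)]
  exact hy t ht

/-- In positive dimension an asymptotically stable closed loop has non-constant data, so common
Lipschitz constants are bounded below. -/
theorem exists_pos_le_lipschitz {n m : ℕ} [Nontrivial (E n)] {Ω : Set (E n)} (hΩ : IsOpen Ω)
    (h0 : (0 : E n) ∈ Ω) {f p : E n → E n} {g : E n → Matrix (Fin n) (Fin m) ℝ} {r : ℝ}
    (hf0 : f 0 = 0) (hp0 : p 0 = 0) (hF : IsAsymptoticallyStable Ω (closedLoop f g r p)) :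
    ∃ l : ℝ, 0 < l ∧ ∀ L : ℝ≥0, LipschitzOnWith L f Ω → LipschitzOnWith L p Ω → l ≤ L := by
  obtain ⟨z, hz, hz0, hfp⟩ : ∃ z ∈ Ω, z ≠ 0 ∧ (f z ≠ 0 ∨ p z ≠ 0) := by
    -- If `f` and `p` vanished on `Ω`, every point near the origin would be an equilibrium, against
    -- attractivity.
    by_contra! hcon
    obtain ⟨η, hη, hatt⟩ := hF.attractive
    obtain ⟨ρ, hρ, hball⟩ := Metric.isOpen_iff.1 hΩ 0 h0
    obtain ⟨z, hz⟩ := _root_.exists_norm_eq (E n) (half_pos (lt_min hη hρ)).le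
    have hlt := half_lt_self (lt_min hη hρ)
    rw [← hz, lt_min_iff] at hlt
    have hzΩ : z ∈ Ω := hball (by simpa using hlt.2)
    have hz0 : z ≠ 0 := by
      rw [← norm_pos_iff, hz]
      exact half_pos (lt_min hη hρ)
    have hFz : closedLoop f g r p z = 0 := by
      rw [closedLoop, (hcon z hzΩ hz0).1, (hcon z hzΩ hz0).2, ← toEuclideanCLM_apply_eq_act,
        map_zero, sub_zero]
    have hlim := hatt z hlt.1 (fun _ => z) ⟨rfl, fun t _ => ⟨hzΩ, by
      rw [hFz]; exact hasDerivWithinAt_const _ _ _⟩⟩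
    exact hz0 (tendsto_nhds_unique tendsto_const_nhds hlim)
  have hzn : 0 < ‖z‖ := norm_pos_iff.2 hz0
  refine ⟨max ‖f z‖ ‖p z‖ / ‖z‖, div_pos ?_ hzn, fun L hfL hpL => ?_⟩
  · rcases hfp with h | h
    · exact lt_max_of_lt_left (norm_pos_iff.2 h)
    · exact lt_max_of_lt_right (norm_pos_iff.2 h)
  · have h1 := hfL.dist_le_mul z hz 0 h0
    have h2 := hpL.dist_le_mul z hz 0 h0
    rw [hf0, dist_zero_right, dist_zero_right] at h1
    rw [hp0, dist_zero_right, dist_zero_right] at h2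
    rw [div_le_iff₀ hzn]
    exact max_le h1 h2

/-- The prefactor of the Gronwall bound is `e / (C L)`, and `b ≤ C (C L)` is exactly what brings it
below `C δ`. -/
theorem gronwallBound_zero_le {C L e δ t b : ℝ} (hC : 0 < C) (hL : 0 < L) (hδ : 0 ≤ δ)
    (hb0 : 0 ≤ b) (he : e = b * δ) (hb : b ≤ C * (C * L)) :
    gronwallBound 0 (C * L) e t ≤ C * δ * Real.exp (C * L * t) := by
  have hCL : 0 < C * L := by positivity
  have h1 : e / (C * L) ≤ C * δ := by
    rw [div_le_iff₀ hCL, he]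
    nlinarith
  rw [gronwallBound_of_K_ne_0 hCL.ne']
  have h2 : 0 ≤ e / (C * L) := by rw [he]; positivity
  have h3 : e / (C * L) * Real.exp (C * L * t) ≤ C * δ * Real.exp (C * L * t) := by gcongr
  linarith

/-! ### Choice of constants and the main theorem -/

theorem theorem3p2 {n m : ℕ} (Ω : Set (E n)) (hΩ : IsBoundedDomain Ω)
    (f : E n → E n) (g : E n → Matrix (Fin n) (Fin m) ℝ) (q : E n → ℝ)
    (r : ℝ) (hr : 0 < r) (A Q P : Matrix (Fin n) (Fin n) ℝ)
    (hC1 : CondC1 Ω f g q A Q) (hC2 : CondC2 A (controlMatrix r g 0) Q)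
    (V : E n → ℝ) (hV : IsStabilizingSolution Ω f g q r V)
    -- `P` is the Hessian of `V` at the origin
    (hP : HasFDerivAt (gradient V) (Matrix.toEuclideanCLM (𝕜 := ℝ) P) 0)
    -- the costate `p = ∇V` is Lipschitz continuous
    (hp : ∃ K : ℝ≥0, LipschitzOnWith K (gradient V) Ω) :
    ∃ C₀ : ℝ, 0 < C₀ ∧
      -- `L` is a common Lipschitz constant of `f`, `g`, `R`, `p`
      ∀ L : ℝ≥0, LipschitzOnWith L f Ω → LipschitzOnWith L g Ω →
        LipschitzOnWith L (controlMatrix r g) Ω → LipschitzOnWith L (gradient V) Ω →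
      ∀ γ₀ k : ℝ, 0 < γ₀ → 0 < k →
      ∃ ε₀ α : ℝ, 0 < ε₀ ∧ ε₀ < γ₀ ∧ 0 < α ∧
        -- the optimal trajectory `x`
        ∀ (x₀ : E n) (x : ℝ → E n), IsSolution Ω (closedLoop f g r (gradient V)) x₀ x →
          Tendsto x atTop (𝓝 0) →
        ∃ ε : ℝ, 0 < ε ∧ ε < ε₀ ∧ ∀ T : ℝ, IsAdmissibleTime x ε T →
        ∃ δ₀ : ℝ, 0 < δ₀ ∧ ∀ δ : ℝ, 0 < δ → δ ≤ δ₀ →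
          ∀ (M : ℕ) (θ : NNParams n M),
            (∀ z : E n, ‖z‖ < γ₀ → ‖θ.eval z - act P z‖ ≤ k * ‖z‖ ^ 2) →
            (∀ z ∈ Ω, ‖θ.eval z - gradient V z‖ < δ) →
            (∃ y : ℝ → E n, IsSolution Ω (closedLoop f g r θ.eval) x₀ y) ∧
            ∀ y : ℝ → E n, IsSolution Ω (closedLoop f g r θ.eval) x₀ y →
              (∀ t : ℝ, 0 ≤ t → t ≤ T → ‖y t - x t‖ ≤ C₀ * δ * Real.exp (C₀ * (L : ℝ) * t)) ∧
              (∀ t : ℝ, T < t → ‖y t‖ ≤ ε₀ * Real.exp (-α * t)) := by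
  -- In dimension zero `L` may be `0` and has no positive lower bound, but all estimates are
  -- trivial.
  rcases subsingleton_or_nontrivial (E n) with hsub | hnt
  · refine ⟨1, one_pos, fun L _ _ _ _ γ₀ k hγ _ => ⟨γ₀ / 2, 1, by positivity, by linarith,
      one_pos, fun x₀ x hx _ => ⟨γ₀ / 4, by positivity, by linarith, fun T _ => ⟨1, one_pos,
      fun δ hδ _ M θ _ _ => ⟨⟨x, hx.1, fun t ht => ⟨(hx.2 t ht).1, ?_⟩⟩,
      fun y _ => ⟨fun t _ _ => ?_, fun t _ => ?_⟩⟩⟩⟩⟩⟩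
    · convert (hx.2 t ht).2 using 1
    · rw [Subsingleton.elim (y t - x t) 0, norm_zero]
      positivity
    · rw [Subsingleton.elim (y t) 0, norm_zero]
      positivity
  set p := gradient V with hp_def
  set F := closedLoop f g r p with hF_def
  obtain ⟨hf0, hfA⟩ := hasFDerivAt_zero_of_isBigO hC1.expand_f
  have hp0 : p 0 = 0 := hV.gradient_zero
  have hΩ0 : Ω ∈ 𝓝 (0 : E n) := hΩ.isOpen.mem_nhds hΩ.zero_mem
  obtain ⟨Kg, hKg⟩ := hC1.lip_g
  obtain ⟨Kp, hKp⟩ := hp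
  have hRc : ContinuousAt (controlMatrix r g) 0 :=
    continuousAt_controlMatrix (hKg.continuousOn.continuousAt hΩ0)
  have hPs : P.IsSymm := isSymm_of_hasFDerivAt_gradient
    (by filter_upwards [hΩ0] with y hy using
      hV.differentiable.differentiableAt (hΩ.isOpen.mem_nhds hy)) hP
  have hric := riccati_of_hamiltonJacobi hf0 hfA hp0 hP hC1.expand_q hRc
    (controlMatrix_isSymm r g 0) hPs hC1.symm_Q
    (by filter_upwards [hΩ0] with y hy using hV.hamiltonJacobi y hy)
  have hhyp := isHyperbolic_closedLoop_of_riccati hC2.hyperbolic hric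
  set B := A - controlMatrix r g 0 * P with hB
  have hpP : ∀ κ > 0, ∀ᶠ z in 𝓝 (0 : E n), ‖p z - act P z‖ ≤ κ * ‖z‖ := fun κ hκ => by
    have := hP.isLittleO.bound hκ
    simpa [hp0, toEuclideanCLM_apply_eq_act] using this
  have hlin : ∀ η > 0, ∃ ρ > 0, ∀ z, ‖z‖ < ρ →
      ‖F z - Matrix.toEuclideanCLM (𝕜 := ℝ) B z‖ ≤ η * ‖z‖ := by
    intro η hη
    obtain ⟨ρ₁, hρ₁, κ, hκ, hclose⟩ := exists_closedLoop_sub_le (P := P) hf0 hfA hRc hη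
    obtain ⟨ρ₂, hρ₂, hball⟩ := Metric.eventually_nhds_iff.1 (hpP κ hκ)
    exact ⟨min ρ₁ ρ₂, lt_min hρ₁ hρ₂, fun z hz => hclose z (p z) (hz.trans_le (min_le_left _ _))
      (hball (by simpa using hz.trans_le (min_le_right _ _)))⟩
  obtain ⟨N, a, c, hN⟩ := exists_isLyapunovForm hV.stabilizing hhyp hlin
  obtain ⟨bR, hbR⟩ := exists_norm_controlMatrix_le r hKg hΩ.bounded
  obtain ⟨bp, hbp⟩ := hKp.exists_norm_le hΩ.bounded
  obtain ⟨l, hl, hlL⟩ := exists_pos_le_lipschitz hΩ.isOpen hΩ.zero_mem hf0 hp0 hV.stabilizing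
  -- The first three terms make `C L` a Lipschitz constant of `F`; the last gives `bR ≤ C L`, with
  -- `l ≤ L` keeping `C` independent of `L`.
  set C : ℝ≥0 := 1 + bR + bp + bR / l.toNNReal with hC
  have hC1' : (1 : ℝ) + bR + bp ≤ C := by
    have : (1 : ℝ≥0) + bR + bp ≤ C := le_self_add
    exact_mod_cast this
  have hC0 : (0 : ℝ) < C := lt_of_lt_of_le (by positivity) hC1'
  have hCl : (bR : ℝ) ≤ C * l := by
    have h1 : bR / l.toNNReal ≤ C := le_add_self
    have h2 : ((bR / l.toNNReal : ℝ≥0) : ℝ) ≤ C := by exact_mod_cast h1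
    rw [NNReal.coe_div, Real.coe_toNNReal l hl.le, div_le_iff₀ hl] at h2
    exact h2
  refine ⟨C, hC0, fun L hfL hgL hRL hpL γ₀ k hγ hk => ?_⟩
  have hlL' : l ≤ L := hlL L hfL hpL
  have hL0 : (0 : ℝ) < L := hl.trans_le hlL'
  have hbCL : (bR : ℝ) ≤ C * (C * L) := by
    have h1 : (C : ℝ) * l ≤ C * L := by gcongr
    have h2 : (1 : ℝ) * (C * L) ≤ C * (C * L) := by
      gcongr
      linarith [bR.2, bp.2]
    linarith
  have hFL : LipschitzOnWith (C * L) F Ω := by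
    refine (lipschitzOnWith_closedLoop hfL hRL hpL hbR hbp).weaken ?_
    rw [← NNReal.coe_le_coe]
    push_cast
    nlinarith
  set b := ‖N‖ + 1 with hb
  have hb0 : 0 < b := by positivity
  have hNb : ‖N‖ ≤ b := by linarith
  have hc0 := hN.rate_pos
  have ha0 := hN.pos
  set β := c / (4 * b) with hβ
  have hβ0 : 0 < β := by positivity
  set κ := √(b / a) + 1 with hκ
  have hκ1 : 1 ≤ κ := by linarith [Real.sqrt_nonneg (b / a)]
  have hκ0 : 0 < κ := by linarith
  obtain ⟨ρ₁, hρ₁, κ₁, hκ₁, hclose⟩ := exists_closedLoop_sub_le (P := P) hf0 hfA hRc hβ0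
  obtain ⟨ρ₂, hρ₂, hball⟩ := Metric.eventually_nhds_iff.1 ((hpP κ₁ hκ₁).and hΩ0)
  -- The bound `κ₁ / k` turns `k ‖z‖²` into at most `κ₁ ‖z‖`, so one radius serves all admissible
  -- networks.
  set ρ := min (min ρ₁ ρ₂) (min γ₀ (κ₁ / k)) with hρ
  have hρ0 : 0 < ρ := by positivity
  have hρρ₁ : ρ ≤ ρ₁ := (min_le_left _ _).trans (min_le_left _ _)
  have hρρ₂ : ρ ≤ ρ₂ := (min_le_left _ _).trans (min_le_right _ _)
  have hργ : ρ ≤ γ₀ := (min_le_right _ _).trans (min_le_left _ _)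
  have hρk : k * ρ ≤ κ₁ := by
    rw [← le_div_iff₀' hk]
    exact (min_le_right _ _).trans (min_le_right _ _)
  have hballF : ∀ z, ‖z‖ < ρ →
      z ∈ Ω ∧ ‖F z - Matrix.toEuclideanCLM (𝕜 := ℝ) B z‖ ≤ β * ‖z‖ := fun z hz => by
    have h := hball (y := z) (by simpa using hz.trans_le hρρ₂)
    exact ⟨h.2, hclose z (p z) (hz.trans_le hρρ₁) h.1⟩
  refine ⟨ρ / 2, β / 2, by positivity, by linarith, by positivity, fun x₀ x hx hxt => ?_⟩
  obtain ⟨D, hD, hxD⟩ := hN.exists_norm_le_exp hNb hb0 hρ0 hballF hx hxt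
  rw [← hβ] at hxD
  set ε₀ := ρ / 2 with hε₀
  have hε₀0 : 0 < ε₀ := by positivity
  -- Multiplying `‖x T‖ < ε / 2` by `‖x T‖ ≤ D exp (-β T)` and taking the root gives decay `exp (-β
  -- T / 2)` with a prefactor that this `ε` makes at most `ε₀ / (2 κ)`, for every `T`.
  set ε := min (ε₀ / 2) (ε₀ ^ 2 / (2 * κ ^ 2 * D)) with hε
  refine ⟨ε, by positivity, (min_le_left _ _).trans_lt (by linarith), fun T hT => ?_⟩
  have hT0 : 0 ≤ T := hT.1.le
  have hxT : ‖x T‖ ≤ ε₀ / (2 * κ) * Real.exp (-(β / 2) * T) := by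
    have h1 := hT.2 T le_rfl
    have h2 := hxD T hT0
    have h3 : ε ≤ ε₀ ^ 2 / (2 * κ ^ 2 * D) := min_le_right _ _
    have h4 : ‖x T‖ ^ 2 ≤ (ε₀ / (2 * κ) * Real.exp (-(β / 2) * T)) ^ 2 := by
      have e : Real.exp (-(β / 2) * T) ^ 2 = Real.exp (-β * T) := by
        rw [← Real.exp_nat_mul]
        congr 1
        push_cast
        ring
      rw [mul_pow, e]
      calc ‖x T‖ ^ 2 = ‖x T‖ * ‖x T‖ := sq _
        _ ≤ (ε₀ ^ 2 / (2 * κ ^ 2 * D) / 2) * (D * Real.exp (-β * T)) := by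
            gcongr
            linarith
        _ = _ := by field_simp
    exact (pow_le_pow_iff_left₀ (norm_nonneg _) (by positivity) two_ne_zero).1 h4
  obtain ⟨σ, hσ, htube⟩ := (isCompact_Icc.image_of_continuousOn
    (hx.continuousOn.mono (Icc_subset_Ici_self : Icc 0 T ⊆ Ici 0))).exists_thickening_subset_open
    hΩ.isOpen (image_subset_iff.2 fun t ht => (hx.2 t ht.1).1)
  have htube' : ∀ t ∈ Icc 0 T, ∀ z, ‖z - x t‖ < σ → z ∈ Ω := fun t ht z hz =>
    htube (Metric.mem_thickening_iff.2 ⟨x t, mem_image_of_mem x ht, by rwa [dist_eq_norm]⟩)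
  -- The first entry keeps `y` strictly inside the tube; the second makes `y T - x T` no larger than
  -- the bound for `x T`.
  set d := min (σ / 2) (ε₀ / (2 * κ) * Real.exp (-(β / 2) * T)) with hd
  have hd0 : 0 < d := by positivity
  refine ⟨d / (C * Real.exp (C * L * T)), by positivity, fun δ hδ hδd M θ hθP hθp => ?_⟩
  have hδd' : C * δ * Real.exp (C * L * T) ≤ d := by
    rw [le_div_iff₀ (by positivity)] at hδd
    linarith
  set G := closedLoop f g r θ.eval with hG
  have hGF : ∀ z ∈ Ω, ‖G z - F z‖ ≤ bR * δ := fun z hz => by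
    have e : G z - F z = - act (controlMatrix r g z) (θ.eval z - p z) := by
      simp only [hG, hF_def, closedLoop, act_sub_right]
      abel
    rw [e, norm_neg]
    exact (norm_act_le _ _).trans (by gcongr; exacts [hbR z hz, (hθp z hz).le])
  have hballG : ∀ z, ‖z‖ < ρ →
      z ∈ Ω ∧ ‖G z - Matrix.toEuclideanCLM (𝕜 := ℝ) B z‖ ≤ β * ‖z‖ := fun z hz => by
    refine ⟨(hballF z hz).1, hclose z _ (hz.trans_le hρρ₁) ((hθP z (hz.trans_le hργ)).trans ?_)⟩
    rw [sq, ← mul_assoc]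
    gcongr
    exact le_trans (by gcongr) hρk
  have hgron : ∀ t, gronwallBound 0 (C * L : ℝ≥0) (bR * δ) t ≤ C * δ * Real.exp (C * L * t) :=
    fun t => by
      rw [NNReal.coe_mul]
      exact gronwallBound_zero_le hC0 hL0 hδ.le bR.2 rfl hbCL
  -- The equation is assumed only while `y` is in `Ω`, so that the same estimates prove existence,
  -- through trajectories of an extended field, and apply to every solution.
  have main : ∀ y : ℝ → E n, ContinuousOn y (Ici 0) → y 0 = x₀ →
      (∀ t, 0 ≤ t → y t ∈ Ω → HasDerivWithinAt y (G (y t)) (Ici t) t) →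
      (∀ t, 0 ≤ t → y t ∈ Ω) ∧
      (∀ t, 0 ≤ t → t ≤ T → ‖y t - x t‖ ≤ C * δ * Real.exp (C * L * t)) ∧
      (∀ t, T < t → ‖y t‖ ≤ ε₀ * Real.exp (-(β / 2) * t)) := by
    intro y hyc hy0 hyd
    have h1 := norm_sub_le_gronwallBound_of_tube hFL (mul_nonneg bR.2 hδ.le) hGF
      (hx.continuousOn.mono Icc_subset_Ici_self) (fun t ht => hx.hasDerivWithinAt_Ici ht.1)
      htube' hyc (hy0.trans hx.1.symm) hyd
      (((hgron T).trans (hδd'.trans (min_le_left _ _))).trans_lt (half_lt_self hσ))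
    have hyT : κ * ‖y T‖ ≤ ε₀ * Real.exp (-(β / 2) * T) := by
      have h2 := (h1 T ⟨hT0, le_rfl⟩).2.trans
        ((hgron T).trans (hδd'.trans (min_le_right _ _)))
      have h3 : ‖y T‖ ≤ ‖y T - x T‖ + ‖x T‖ := by
        simpa using norm_add_le (y T - x T) (x T)
      calc κ * ‖y T‖ ≤ κ * (ε₀ / (2 * κ) * Real.exp (-(β / 2) * T) +
            ε₀ / (2 * κ) * Real.exp (-(β / 2) * T)) := by gcongr; linarith
        _ = _ := by field_simp; ring
    have hexp1 : Real.exp (-(β / 2) * T) ≤ 1 := by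
      rw [Real.exp_le_one_iff]
      have : 0 ≤ β / 2 * T := by positivity
      linarith
    have hstart : κ * ‖y T‖ < ρ := by
      have : ε₀ * Real.exp (-(β / 2) * T) ≤ ε₀ := mul_le_of_le_one_right hε₀0.le hexp1
      linarith
    have h4 := fun t (ht : T ≤ t) => hN.norm_le_of_ball hNb hb0 hballG
      (hyc.mono (Ici_subset_Ici.2 hT0)) (fun t ht => hyd t (hT0.trans ht)) hstart ht
    refine ⟨fun t ht => ?_, fun t ht htT => (h1 t ⟨ht, htT⟩).2.trans (hgron t), fun t ht => ?_⟩
    · rcases le_total t T with htT | htT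
      · exact (h1 t ⟨ht, htT⟩).1
      · exact (h4 t htT).1
    · calc ‖y t‖ ≤ κ * ‖y T‖ * Real.exp (-β * (t - T)) := (h4 t ht.le).2
        _ ≤ ε₀ * Real.exp (-(β / 2) * T) * Real.exp (-(β / 2) * (t - T)) := by
            gcongr
            linarith
        _ = ε₀ * Real.exp (-(β / 2) * t) := by
            rw [mul_assoc, ← Real.exp_add]
            congr 2
            ring
  refine ⟨?_, fun y hy => (main y hy.continuousOn hy.1
    fun t ht _ => hy.hasDerivWithinAt_Ici ht).2⟩
  -- The Lipschitz constant of the network depends on `θ`, but it enters none of the estimates.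
  obtain ⟨Kθ, hKθ⟩ := θ.exists_lipschitzOnWith_eval hΩ.bounded
  obtain ⟨bθ, hbθ⟩ := hKθ.exists_norm_le hΩ.bounded
  exact exists_isSolution hΩ.bounded (lipschitzOnWith_closedLoop hfL hRL hKθ hbR hbθ)
    fun y hyc hy0 hyd => (main y hyc hy0 hyd).1
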